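/- **Setting.** Let $\Omega\subset\mathbb R^3$ be a bounded open set, and let $\mathcal E=\{\mathbf F\in H(\mathbf{curl},\Omega):\mathbf F\times\mathbf n|_{\partial\Omega}=0\}$, $\mathcal B=\{\mathbf F\in H(\mathrm{div},\Omega):\mathbf F\cdot\mathbf n|_{\partial\Omega}=0\}$ (curl, divergence and boundary traces in the weak sense, through Green's formula with test fields smooth up to the boundary). Let $\mathcal E_h\subset\mathcal E$ and $\mathcal B_h\subset\mathcal B$ be finite-dimensional subspaces with bases $(\mathbf W^e_j)_{j\le N_e}$, $(\mathbf W^b_j)_{j\le N_b}$ and with $\nabla\times\mathcal E_h\subset\mathcal B_h$. Let $S:\mathbb R^3\to\mathbb R$ be a smooth shape function (the smooth replacement of the Dirac delta) and let $\omega_s\neq0$, $s=1,\dots,N$, be the particle weights. With $(\mathbf f,\mathbf g)=\int_\Omega\mathbf f\cdot\mathbf g\,d\mathbf x$ put $(\mathcal W_e)_{ij}=(\mathbf W^e_i,\mathbf W^e_j)$, $(\mathcal W_b)_{ij}=(\mathbf W^b_i,\mathbf W^b_j)$, $\mathcal K_{ij}=(\nabla\times\mathbf W^e_i,\mathbf W^b_j)$,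 and let $\mathcal W^S_e(\mathbf X)\in\mathbb R^{N_e\times3}$, $\mathcal W^S_b(\mathbf X)\in\mathbb R^{N_b\times3}$ have $j$-th rows $\int_\Omega \mathbf W^{e}_j(\mathbf x)^{\top}S(\mathbf x-\mathbf X)\,d\mathbf x$ and $\int_\Omega \mathbf W^{b}_j(\mathbf x)^{\top}S(\mathbf x-\mathbf X)\,d\mathbf x$. On the space of the variables $z=(\mathbf X_s,\mathbf V_s,\mathbf E_D,\mathbf B_D)\in(\mathbb R^3)^N\times(\mathbb R^3)^N\times\mathbb R^{N_e}\times\mathbb R^{N_b}$ consider the bracket $$\begin{aligned}\{F,G\}=&\sum_s\frac1{\omega_s}\Big(\frac{\partial F}{\partial\mathbf X_s}\cdot\frac{\partial G}{\partial\mathbf V_s}-\frac{\partial G}{\partial\mathbf X_s}\cdot\frac{\partial F}{\partial\mathbf V_s}\Big) +\Big(\frac{\partial F}{\partial\mathbf E_D}\Big)^{\top}\mathcal W_e^{-1}\mathcal K\mathcal W_b^{-1}\frac{\partial G}{\partial\mathbf B_D}-\Big(\frac{\partial G}{\partial\mathbf E_D}\Big)^{\top}\mathcal W_e^{-1}\mathcal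 K\mathcal W_b^{-1}\frac{\partial F}{\partial\mathbf B_D}\\ &+\sum_s\Big(\Big(\frac{\partial G}{\partial\mathbf E_D}\Big)^{\top}\mathcal W_e^{-1}\mathcal W_e^S(\mathbf X_s)\frac{\partial F}{\partial\mathbf V_s}-\Big(\frac{\partial F}{\partial\mathbf E_D}\Big)^{\top}\mathcal W_e^{-1}\mathcal W_e^S(\mathbf X_s)\frac{\partial G}{\partial\mathbf V_s}\Big) +\sum_s\frac1{\omega_s}\mathbf B_D^{\top}\mathcal W_b^S(\mathbf X_s)\Big(\frac{\partial F}{\partial\mathbf V_s}\times\frac{\partial G}{\partial\mathbf V_s}\Big),\end{aligned}$$ the Hamiltonian $H=\frac12\sum_s\omega_s|\mathbf V_s|^2+\frac12\mathbf E_D^{\top}\mathcal W_e\mathbf E_D+\frac12\mathbf B_D^{\top}\mathcal W_b\mathbf B_D$, and the numerical magnetic field $\mathbf B_h=\sum_jB_j\mathbf W^b_j$. **Theorem.** (1) *Splitting.* $H=H_E+H_B+H_1+H_2+H_3$ with $H_E=\frac12\mathbf E_D^{\top}\mathcal W_e\mathbf E_D$, $H_B=\frac12\mathbf B_D^{\top}\mathcal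 W_b\mathbf B_D$, $H_i=\frac12\sum_s\omega_s V_s[i]^2$. The equations $\dot F=\{F,H\}$ (for all smooth $F$) are equivalent to the semi-discrete system $$\dot{\mathbf X}_s=\mathbf V_s,\quad \dot{\mathbf V}_s=\mathcal W_e^S(\mathbf X_s)^{\top}\mathbf E_D+\mathbf V_s\times(\mathcal W_b^S(\mathbf X_s)^{\top}\mathbf B_D),\quad \dot{\mathbf E}_D=\mathcal W_e^{-1}\Big(\mathcal K\mathbf B_D-\sum_s\omega_s\mathcal W_e^S(\mathbf X_s)\mathbf V_s\Big),\quad \dot{\mathbf B}_D=-\mathcal W_b^{-1}\mathcal K^{\top}\mathbf E_D,$$ and the equations $\dot F=\{F,H_E\}$, $\dot F=\{F,H_B\}$, $\dot F=\{F,H_i\}$ (for all smooth $F$) are equivalent, respectively, to $$\begin{aligned}&\dot{\mathbf X}_s=0,\ \ \dot{\mathbf V}_s=\mathcal W_e^S(\mathbf X_s)^{\top}\mathbf E_D,\ \ \dot{\mathbf E}_D=0,\ \ \dot{\mathbf B}_D=-\mathcal W_b^{-1}\mathcal K^{\top}\mathbf E_D;\\ &\dot{\mathbf X}_s=0,\ \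 \dot{\mathbf V}_s=0,\ \ \dot{\mathbf E}_D=\mathcal W_e^{-1}\mathcal K\mathbf B_D,\ \ \dot{\mathbf B}_D=0;\\ &\dot{\mathbf X}_s=V_s[i]\mathbf e_i,\ \ \dot{\mathbf V}_s=V_s[i]\,\mathbf e_i\times(\mathcal W_b^S(\mathbf X_s)^{\top}\mathbf B_D),\ \ \dot{\mathbf E}_D=-\mathcal W_e^{-1}\sum_s\omega_sV_s[i]\mathcal W_e^S(\mathbf X_s)\mathbf e_i,\ \ \dot{\mathbf B}_D=0.\end{aligned}$$ (2) *Explicit exact solutions.* On every open interval containing $0$, the unique solutions with initial value $(\mathbf X_s,\mathbf V_s,\mathbf E_D,\mathbf B_D)$ of the subsystems of $H_E$, $H_B$ and $H_i$ are given, respectively, by the explicit maps $$\begin{aligned}\phi^E(t):&\ \big(\mathbf X_s,\ \mathbf V_s+t\,\mathcal W_e^S(\mathbf X_s)^{\top}\mathbf E_D,\ \mathbf E_D,\ \mathbf B_D-t\,\mathcal W_b^{-1}\mathcal K^{\top}\mathbf E_D\big),\\ \phi^B(t):&\ \big(\mathbf X_s,\ \mathbf V_s,\ \mathbf E_D+t\,\mathcal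 W_e^{-1}\mathcal K\mathbf B_D,\ \mathbf B_D\big),\\ \phi^{v_i}(t):&\ \big(\mathbf X_s+tV_s[i]\mathbf e_i,\ \mathbf V_s+\mathbf e_i\times(F^b_{s}{}^{\top}\mathbf B_D),\ \mathbf E_D-\mathcal W_e^{-1}\textstyle\sum_s\omega_sF^e_{s}\mathbf e_i,\ \mathbf B_D\big),\end{aligned}$$ where $F^{e}_s$ and $F^b_s$ are the integrals of $\mathcal W^S_{e}$ and $\mathcal W^S_b$ with respect to the $i$-th coordinate of the position, from $X_s[i]$ to $X_s[i]+tV_s[i]$, the other two coordinates being those of $\mathbf X_s$. (3) *Divergence.* Each of these maps leaves the weak divergence $\nabla\cdot\mathbf B_h$ unchanged. Hence, for every finite composition $\Phi$ of the maps $\phi^E(t),\phi^B(t),\phi^{v_i}(t)$ with arbitrary real step sizes, $\nabla\cdot\mathbf B_h=0$ at the initial value implies $\nabla\cdot\mathbf B_h=0$ after any number of applications of $\Phi$. (4) *Poisson bracket.* Every such composition $\Phi$ is a smooth map and preserves the bracket: $\{F\circ\Phi,G\circ\Phi\}(z)=\{F,G\}(\Phi(z))$ for all smooth $F,G$ and all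 $z$ with $\nabla\cdot\mathbf B_h=0$. (5) *The two schemes.* The semi-discrete system has a local solution through every point. The composition $\phi^E(h)\circ\phi^B(h)\circ\phi^{v_1}(h)\circ\phi^{v_2}(h)\circ\phi^{v_3}(h)$ has order one for the semi-discrete system, and the composition $\phi^E(\frac h2)\circ\phi^B(\frac h2)\circ\phi^{v_1}(\frac h2)\circ\phi^{v_2}(\frac h2)\circ\phi^{v_3}(h)\circ\phi^{v_2}(\frac h2)\circ\phi^{v_1}(\frac h2)\circ\phi^B(\frac h2)\circ\phi^E(\frac h2)$ has order two and is symmetric, $\Phi(h)\circ\Phi(-h)=\mathrm{id}$. Here order $p$ means that the local error at every point, $\Phi(h)z-\gamma(h)$ with $\gamma$ the solution through $\gamma(0)=z$, is $O(h^{p+1})$ as $h\to0$. -/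

import Mathlib

open MeasureTheory Filter Topology Matrix
open scoped ContDiff InnerProductSpace

noncomputable section

namespace VMPIC

/-! ### Fields on the spatial domain -/

/-- Physical space `ℝ³` with its Euclidean structure. -/
abbrev R3 : Type := EuclideanSpace ℝ (Fin 3)

/-- `L²(Ω)³`, with the inner product `(f, g) = ∫_Ω f · g`. -/
abbrev L2Vec (Ω : Set R3) : Type := Lp R3 2 (volume.restrict Ω)

/-- `L²(Ω)`. -/
abbrev L2Scal (Ω : Set R3) : Type := Lp ℝ 2 (volume.restrict Ω)

/-- The partial derivative `∂_a φ_b` of a vector field. -/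
def partialDeriv (φ : R3 → R3) (a b : Fin 3) (x : R3) : ℝ :=
  (fderiv ℝ φ x (EuclideanSpace.single a 1)) b

/-- The classical curl of a smooth vector field. -/
def curl (φ : R3 → R3) (x : R3) : R3 :=
  !₂[partialDeriv φ 1 2 x - partialDeriv φ 2 1 x,
     partialDeriv φ 2 0 x - partialDeriv φ 0 2 x,
     partialDeriv φ 0 1 x - partialDeriv φ 1 0 x]

/-- `G = ∇ × F` in the sense of distributions on `Ω`. -/
def IsWeakCurl (Ω : Set R3) (F G : L2Vec Ω) : Prop :=
  ∀ φ : R3 → R3, ContDiff ℝ ∞ φ → HasCompactSupport φ → tsupport φ ⊆ Ω →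
    ∫ x in Ω, ⟪F x, curl φ x⟫_ℝ = ∫ x in Ω, ⟪G x, φ x⟫_ℝ

/-- `g = ∇ · F` in the sense of distributions on `Ω`. -/
def IsWeakDiv (Ω : Set R3) (F : L2Vec Ω) (g : L2Scal Ω) : Prop :=
  ∀ ψ : R3 → ℝ, ContDiff ℝ ∞ ψ → HasCompactSupport ψ → tsupport ψ ⊆ Ω →
    ∫ x in Ω, ⟪F x, gradient ψ x⟫_ℝ = - ∫ x in Ω, g x * ψ x

open Classical in
/-- The weak curl of a field that has one in `L²` (it is then unique); `0` otherwise. -/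
def weakCurl (Ω : Set R3) (F : L2Vec Ω) : L2Vec Ω :=
  if h : ∃ G, IsWeakCurl Ω F G then h.choose else 0

open Classical in
/-- The weak divergence of a field that has one in `L²` (it is then unique); `0` otherwise. -/
def weakDiv (Ω : Set R3) (F : L2Vec Ω) : L2Scal Ω :=
  if h : ∃ g, IsWeakDiv Ω F g then h.choose else 0

/-- `n × F = 0` on `∂Ω`, for `F ∈ H(curl, Ω)` and bounded `Ω`: the boundary term in Green's formula
for the curl vanishes against every vector field that is smooth up to the boundary. -/
def ZeroTangentialTrace (Ω : Set R3) (F : L2Vec Ω) : Prop :=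
  ∀ φ : R3 → R3, ContDiff ℝ ∞ φ →
    ∫ x in Ω, ⟪F x, curl φ x⟫_ℝ = ∫ x in Ω, ⟪weakCurl Ω F x, φ x⟫_ℝ

/-- `n · F = 0` on `∂Ω`, for `F ∈ H(div, Ω)` and bounded `Ω`: the boundary term in Green's formula
for the divergence vanishes against every function that is smooth up to the boundary. -/
def ZeroNormalTrace (Ω : Set R3) (F : L2Vec Ω) : Prop :=
  ∀ ψ : R3 → ℝ, ContDiff ℝ ∞ ψ →
    ∫ x in Ω, ⟪F x, gradient ψ x⟫_ℝ = - ∫ x in Ω, weakDiv Ω F x * ψ x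

/-- `{F ∈ H(curl, Ω) : F × n = 0 on ∂Ω}`. -/
def electricSpace (Ω : Set R3) : Set (L2Vec Ω) :=
  {F | (∃ G, IsWeakCurl Ω F G) ∧ ZeroTangentialTrace Ω F}

/-- `{F ∈ H(div, Ω) : F · n = 0 on ∂Ω}`. -/
def magneticSpace (Ω : Set R3) : Set (L2Vec Ω) :=
  {F | (∃ g, IsWeakDiv Ω F g) ∧ ZeroNormalTrace Ω F}

/-! ### The semi-discrete system -/

/-- The data of a discretisation: the domain `Ω`, the basis functions `We`, `Wb` of the two finite
element spaces, the shape function `S` of the particles and the weights `weight` of the particles. -/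
structure Discretisation (N Ne Nb : ℕ) where
  Ω : Set R3
  We : Fin Ne → L2Vec Ω
  Wb : Fin Nb → L2Vec Ω
  S : R3 → ℝ
  weight : Fin N → ℝ

/-- The discrete variables `(X_s, V_s, E_D, B_D)`. -/
abbrev Phase (N Ne Nb : ℕ) : Type :=
  (Fin N → Fin 3 → ℝ) × (Fin N → Fin 3 → ℝ) × (Fin Ne → ℝ) × (Fin Nb → ℝ)

section Gradients

variable {N Ne Nb : ℕ} (F : Phase N Ne Nb → ℝ) (z : Phase N Ne Nb)

/-- `∂F/∂X_s`. -/
def gradX (s : Fin N) : Fin 3 → ℝ := fun k =>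
  fderiv ℝ F z (Pi.single s (Pi.single k 1), 0, 0, 0)

/-- `∂F/∂V_s`. -/
def gradV (s : Fin N) : Fin 3 → ℝ := fun k =>
  fderiv ℝ F z (0, Pi.single s (Pi.single k 1), 0, 0)

/-- `∂F/∂E_D`. -/
def gradE : Fin Ne → ℝ := fun j => fderiv ℝ F z (0, 0, Pi.single j 1, 0)

/-- `∂F/∂B_D`. -/
def gradB : Fin Nb → ℝ := fun j => fderiv ℝ F z (0, 0, 0, Pi.single j 1)

end Gradients

/-- The five parts of the splitting: `E`, `B` and the three Cartesian directions of velocity. -/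
inductive Part where
  | E : Part
  | B : Part
  | v (i : Fin 3) : Part

namespace Discretisation

variable {N Ne Nb : ℕ} (D : Discretisation N Ne Nb)

/-- The finite element space of the electric field. -/
def Eh : Submodule ℝ (L2Vec D.Ω) := Submodule.span ℝ (Set.range D.We)

/-- The finite element space of the magnetic field. -/
def Bh : Submodule ℝ (L2Vec D.Ω) := Submodule.span ℝ (Set.range D.Wb)

/-- The numerical magnetic field `∑_j B_j W_j^b`. -/
def magneticField (z : Phase N Ne Nb) : L2Vec D.Ω := ∑ j, z.2.2.2 j • D.Wb j

/-- The mass matrix `(W_i^e, W_j^e)`. -/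
def massE : Matrix (Fin Ne) (Fin Ne) ℝ := Matrix.of fun i j => ⟪D.We i, D.We j⟫_ℝ

/-- The mass matrix `(W_i^b, W_j^b)`. -/
def massB : Matrix (Fin Nb) (Fin Nb) ℝ := Matrix.of fun i j => ⟪D.Wb i, D.Wb j⟫_ℝ

/-- The matrix `(∇ × W_i^e, W_j^b)`. -/
def curlMatrix : Matrix (Fin Ne) (Fin Nb) ℝ :=
  Matrix.of fun i j => ⟪weakCurl D.Ω (D.We i), D.Wb j⟫_ℝ

/-- The matrix with `j`-th row `∫_Ω W_j^e(x)ᵀ S(x - X) dx`. -/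
def sampleE (X : Fin 3 → ℝ) : Matrix (Fin Ne) (Fin 3) ℝ :=
  Matrix.of fun j k => ∫ x in D.Ω, D.We j x k * D.S (x - WithLp.toLp 2 X)

/-- The matrix with `j`-th row `∫_Ω W_j^b(x)ᵀ S(x - X) dx`. -/
def sampleB (X : Fin 3 → ℝ) : Matrix (Fin Nb) (Fin 3) ℝ :=
  Matrix.of fun j k => ∫ x in D.Ω, D.Wb j x k * D.S (x - WithLp.toLp 2 X)

/-- The discrete non-canonical bracket `{F, G}`. -/
def bracket (F G : Phase N Ne Nb → ℝ) (z : Phase N Ne Nb) : ℝ :=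
  ∑ s, (1 / D.weight s) * (gradX F z s ⬝ᵥ gradV G z s - gradX G z s ⬝ᵥ gradV F z s)
  + (gradE F z ⬝ᵥ (D.massE⁻¹ * D.curlMatrix * D.massB⁻¹) *ᵥ gradB G z
    - gradE G z ⬝ᵥ (D.massE⁻¹ * D.curlMatrix * D.massB⁻¹) *ᵥ gradB F z)
  + ∑ s, (gradE G z ⬝ᵥ (D.massE⁻¹ * D.sampleE (z.1 s)) *ᵥ gradV F z s
    - gradE F z ⬝ᵥ (D.massE⁻¹ * D.sampleE (z.1 s)) *ᵥ gradV G z s)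
  + ∑ s, (1 / D.weight s) *
      (z.2.2.2 ⬝ᵥ D.sampleB (z.1 s) *ᵥ (crossProduct (gradV F z s) (gradV G z s)))

/-- The discrete Hamiltonian. -/
def hamiltonian (z : Phase N Ne Nb) : ℝ :=
  1 / 2 * ∑ s, D.weight s * (z.2.1 s ⬝ᵥ z.2.1 s)
  + 1 / 2 * (z.2.2.1 ⬝ᵥ D.massE *ᵥ z.2.2.1)
  + 1 / 2 * (z.2.2.2 ⬝ᵥ D.massB *ᵥ z.2.2.2)

/-- The semi-discrete Vlasov-Maxwell system, as a vector field on the discrete phase space. -/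
def field (z : Phase N Ne Nb) : Phase N Ne Nb :=
  (fun s => z.2.1 s,
   fun s => (D.sampleE (z.1 s))ᵀ *ᵥ z.2.2.1
      + crossProduct (z.2.1 s) ((D.sampleB (z.1 s))ᵀ *ᵥ z.2.2.2),
   D.massE⁻¹ *ᵥ (D.curlMatrix *ᵥ z.2.2.2 - ∑ s, D.weight s • D.sampleE (z.1 s) *ᵥ z.2.1 s),
   -(D.massB⁻¹ *ᵥ D.curlMatrixᵀ *ᵥ z.2.2.1))

/-! ### The splitting -/

/-- The Hamiltonians `H_E`, `H_B`, `H_1`, `H_2`, `H_3`. -/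
def partHamiltonian : Part → Phase N Ne Nb → ℝ
  | .E, z => 1 / 2 * (z.2.2.1 ⬝ᵥ D.massE *ᵥ z.2.2.1)
  | .B, z => 1 / 2 * (z.2.2.2 ⬝ᵥ D.massB *ᵥ z.2.2.2)
  | .v i, z => 1 / 2 * ∑ s, D.weight s * z.2.1 s i ^ 2

/-- The five subsystems, as vector fields. -/
def partField : Part → Phase N Ne Nb → Phase N Ne Nb
  | .E, z =>
      (0, fun s => (D.sampleE (z.1 s))ᵀ *ᵥ z.2.2.1, 0,
        -(D.massB⁻¹ *ᵥ D.curlMatrixᵀ *ᵥ z.2.2.1))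
  | .B, z => (0, 0, D.massE⁻¹ *ᵥ D.curlMatrix *ᵥ z.2.2.2, 0)
  | .v i, z =>
      (fun s => z.2.1 s i • Pi.single i 1,
       fun s => z.2.1 s i • crossProduct (Pi.single i 1) ((D.sampleB (z.1 s))ᵀ *ᵥ z.2.2.2),
       -(D.massE⁻¹ *ᵥ ∑ s, (D.weight s * z.2.1 s i) • D.sampleE (z.1 s) *ᵥ Pi.single i 1),
       0)

/-- The entrywise integral of a matrix function along the segment on which the `i`-th
coordinate of the position runs from `X i` to `X i + d`. -/
def lineIntegral {n : ℕ} (M : (Fin 3 → ℝ) → Matrix (Fin n) (Fin 3) ℝ) (i : Fin 3)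
    (X : Fin 3 → ℝ) (d : ℝ) : Matrix (Fin n) (Fin 3) ℝ :=
  Matrix.of fun j k => ∫ ξ in (X i)..(X i + d), M (Function.update X i ξ) j k

/-- The explicit update maps of the five subsystems, with step size `t`. -/
def flow : Part → ℝ → Phase N Ne Nb → Phase N Ne Nb
  | .E, t, z =>
      (z.1, fun s => z.2.1 s + t • (D.sampleE (z.1 s))ᵀ *ᵥ z.2.2.1, z.2.2.1,
        z.2.2.2 - t • D.massB⁻¹ *ᵥ D.curlMatrixᵀ *ᵥ z.2.2.1)
  | .B, t, z =>
      (z.1, z.2.1, z.2.2.1 + t • D.massE⁻¹ *ᵥ D.curlMatrix *ᵥ z.2.2.2, z.2.2.2)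
  | .v i, t, z =>
      (fun s => z.1 s + (t * z.2.1 s i) • Pi.single i 1,
       fun s => z.2.1 s + crossProduct (Pi.single i 1)
          ((lineIntegral D.sampleB i (z.1 s) (t * z.2.1 s i))ᵀ *ᵥ z.2.2.2),
       z.2.2.1 - D.massE⁻¹ *ᵥ
          ∑ s, D.weight s • lineIntegral D.sampleE i (z.1 s) (t * z.2.1 s i) *ᵥ Pi.single i 1,
       z.2.2.2)

/-- The composition `φ^{k₁}(t₁) ∘ ⋯ ∘ φ^{kₘ}(tₘ)` of update maps of the subsystems. -/
def compose : List (Part × ℝ) → Phase N Ne Nb → Phase N Ne Nb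
  | [], z => z
  | (k, t) :: l, z => D.flow k t (compose l z)

/-- `φ^E(h) ∘ φ^B(h) ∘ φ^{v₁}(h) ∘ φ^{v₂}(h) ∘ φ^{v₃}(h)`. -/
def firstOrderScheme (h : ℝ) : Phase N Ne Nb → Phase N Ne Nb :=
  D.compose [(.E, h), (.B, h), (.v 0, h), (.v 1, h), (.v 2, h)]

/-- `φ^E(h/2) ∘ φ^B(h/2) ∘ φ^{v₁}(h/2) ∘ φ^{v₂}(h/2) ∘ φ^{v₃}(h) ∘ φ^{v₂}(h/2) ∘ φ^{v₁}(h/2) ∘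
φ^B(h/2) ∘ φ^E(h/2)`. -/
def secondOrderScheme (h : ℝ) : Phase N Ne Nb → Phase N Ne Nb :=
  D.compose [(.E, h / 2), (.B, h / 2), (.v 0, h / 2), (.v 1, h / 2), (.v 2, h),
    (.v 1, h / 2), (.v 0, h / 2), (.B, h / 2), (.E, h / 2)]

/-- The curve `γ` solves `dF/dt = {F, H}` on `I`, for every smooth function `F`. -/
def SolvesBracket (H : Phase N Ne Nb → ℝ) (I : Set ℝ) (γ : ℝ → Phase N Ne Nb) : Prop :=
  ∀ F : Phase N Ne Nb → ℝ, ContDiff ℝ ∞ F →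
    ∀ t ∈ I, HasDerivAt (fun τ => F (γ τ)) (D.bracket F H (γ t)) t

/-- `γ` is a solution of the semi-discrete system, defined near time `0`, with initial value `z`. -/
def IsLocalSolution (z : Phase N Ne Nb) (γ : ℝ → Phase N Ne Nb) : Prop :=
  γ 0 = z ∧ ∀ᶠ t in 𝓝 (0 : ℝ), HasDerivAt γ (D.field (γ t)) t

/-- The one-step method `Φ` has order `p` for the semi-discrete system: its local error is
`O(h^(p+1))`. -/
def HasOrder (p : ℕ) (Φ : ℝ → Phase N Ne Nb → Phase N Ne Nb) : Prop :=
  ∀ z γ, D.IsLocalSolution z γ →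
    (fun h => Φ h z - γ h) =O[𝓝 (0 : ℝ)] fun h => h ^ (p + 1)

end Discretisation

end VMPIC

end

noncomputable section

namespace VMPIC

/-! Splitting. The differential of each part of the Hamiltonian is explicit, and in the bracket the
factors `massE`, `massB` and the weights cancel against their inverses, so `{F, H_k}` is the
differential of `F` applied to `partField k` (`bracket_partHamiltonian`). Linear test functions turn
this into the differential equation (`solvesBracket_iff`). Each subsystem is solved by quadrature:
whatever its right-hand side depends on is either conserved or moves on a known straight line
(`eq_flow_iff`). For `H_i` this works because `e_i × w` has no `i`-th component, so `V_s[i]` is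
conserved.

Divergence. Since the curls of the electric space lie in the magnetic space, `massB⁻¹ curlMatrixᵀ p`
is the coefficient vector of the weak curl of `∑ p_j W_j^e` (`weakCurl_We`). Only the `E` substep
changes the magnetic field, and it does so by a weak curl, which is weakly divergence-free.

Bracket. The Jacobi identity is not used; the invariance is checked by the chain rule for each kind
of substep. Two relations between the sampled fields carry it: the curl of the sampled electric
field is the sampled curl (`curl_sampleE`), and the sampled magnetic field is divergence-free
whenever `∇·B_h = 0` (`div_sampleB`). Both hold at every position, even if the shape function
reaches across the boundary, because the trace conditions allow test fields that do not vanish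
there. In the `E` substep the antisymmetric part of the Jacobian of the kick is a curl, which the
update of `B_D` compensates. The `B` substep needs only the symmetry of `massB`. In a velocity
substep both relations are integrated along the path of each particle, and what remains is algebra
for one particle (`single_particle_identity`).

Order. A curve is recorded by its expansion `z + hA + h²B + O(h³)` (`HasJet`). A substep with field
`f` and step `ch` sends `A` to `A + c f` and `B` to `B + c f'A + (c²/2) f'f` (`HasJet.flow`).
Iterating and comparing with the expansion of a solution gives the orders: `A` suffices for the
first scheme, and for the palindromic one `B` agrees as well. -/

theorem fderiv_eq_of_line {E F : Type*} [NormedAddCommGroup E] [NormedSpace ℝ E]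
    [NormedAddCommGroup F] [NormedSpace ℝ F] {f : E → F} {z u : E} {c : F}
    (hf : DifferentiableAt ℝ f z)
    (h : HasDerivAt (fun τ : ℝ => f (z + τ • u)) c 0) : fderiv ℝ f z u = c := by
  rw [← hf.lineDeriv_eq_fderiv]
  exact HasLineDerivAt.lineDeriv h

/-- The part Hamiltonians are quadratic forms, hence have exactly this shape along every line; their
differentials can then be read off by algebra. -/
theorem hasDerivAt_quadratic {f : ℝ → ℝ} {a b c : ℝ} (h : ∀ τ, f τ = a + τ * b + τ ^ 2 * c) :
    HasDerivAt f b 0 := by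
  rw [funext h]
  simpa using (((hasDerivAt_id' (0 : ℝ)).mul_const b).const_add a).fun_add
    (((hasDerivAt_id' (0 : ℝ)).fun_pow 2).mul_const c)

/-! ### Partial gradients and the differential on phase space. -/

section Gradients

variable {N Ne Nb : ℕ}

/-- The differential in terms of the four partial gradients. -/
theorem clm_apply_eq (L : Phase N Ne Nb →L[ℝ] ℝ) (w : Phase N Ne Nb) :
    L w = ∑ s, (fun k => L (Pi.single s (Pi.single k 1), 0, 0, 0)) ⬝ᵥ w.1 s
      + ∑ s, (fun k => L (0, Pi.single s (Pi.single k 1), 0, 0)) ⬝ᵥ w.2.1 s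
      + (fun j => L (0, 0, Pi.single j 1, 0)) ⬝ᵥ w.2.2.1
      + (fun j => L (0, 0, 0, Pi.single j 1)) ⬝ᵥ w.2.2.2 := by
  obtain ⟨x, v, e, b⟩ := w
  have h2 : ∀ (n : ℕ) (A : (Fin n → ℝ) →ₗ[ℝ] ℝ) (y : Fin n → ℝ),
      A y = (fun k => A (Pi.single k 1)) ⬝ᵥ y := by
    intro n A y
    conv_lhs => rw [pi_eq_sum_univ' y]
    simp [dotProduct, mul_comm]
  have h1 : ∀ (A : (Fin N → Fin 3 → ℝ) →ₗ[ℝ] ℝ) (y : Fin N → Fin 3 → ℝ),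
      A y = ∑ s, (fun k => A (Pi.single s (Pi.single k 1))) ⬝ᵥ y s := by
    intro A y
    conv_lhs => rw [← Finset.univ_sum_single y]
    rw [map_sum]
    refine Finset.sum_congr rfl fun s _ => ?_
    exact h2 3 (A ∘ₗ LinearMap.single ℝ (fun _ => Fin 3 → ℝ) s) (y s)
  have hw : ((x, v, e, b) : Phase N Ne Nb)
      = (x, 0, 0, 0) + (0, v, 0, 0) + (0, 0, e, 0) + (0, 0, 0, b) := by simp
  rw [hw, map_add, map_add, map_add]
  have a1 := h1 (L.toLinearMap ∘ₗ LinearMap.inl ℝ _ _) x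
  have a2 := h1 (L.toLinearMap ∘ₗ LinearMap.inr ℝ _ _ ∘ₗ LinearMap.inl ℝ _ _) v
  have a3 := h2 Ne (L.toLinearMap ∘ₗ LinearMap.inr ℝ _ _ ∘ₗ LinearMap.inr ℝ _ _ ∘ₗ
    LinearMap.inl ℝ _ _) e
  have a4 := h2 Nb (L.toLinearMap ∘ₗ LinearMap.inr ℝ _ _ ∘ₗ LinearMap.inr ℝ _ _ ∘ₗ
    LinearMap.inr ℝ _ _) b
  simp only [LinearMap.comp_apply, LinearMap.inl_apply, LinearMap.inr_apply,
    ContinuousLinearMap.coe_coe] at a1 a2 a3 a4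
  simp only [Prod.fst_add, Prod.snd_add, add_zero, zero_add]
  exact congrArg₂ _ (congrArg₂ _ (congrArg₂ _ a1 a2) a3) a4

theorem fderiv_apply_eq (F : Phase N Ne Nb → ℝ) (z w : Phase N Ne Nb) :
    fderiv ℝ F z w = ∑ s, gradX F z s ⬝ᵥ w.1 s + ∑ s, gradV F z s ⬝ᵥ w.2.1 s
      + gradE F z ⬝ᵥ w.2.2.1 + gradB F z ⬝ᵥ w.2.2.2 :=
  clm_apply_eq _ _

end Gradients

/-! ### Symmetry and invertibility of the mass matrices. -/

namespace Discretisation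

variable {N Ne Nb : ℕ} (D : Discretisation N Ne Nb)

theorem massE_transpose : D.massEᵀ = D.massE := by
  ext i j; simp [massE, real_inner_comm]

theorem massB_transpose : D.massBᵀ = D.massB := by
  ext i j; simp [massB, real_inner_comm]

theorem isUnit_det_massE (h : LinearIndependent ℝ D.We) : IsUnit D.massE.det :=
  (Matrix.isUnit_iff_isUnit_det _).1 (posDef_gram_of_linearIndependent h).isUnit

theorem isUnit_det_massB (h : LinearIndependent ℝ D.Wb) : IsUnit D.massB.det :=
  (Matrix.isUnit_iff_isUnit_det _).1 (posDef_gram_of_linearIndependent h).isUnit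

theorem massE_inv_transpose : (D.massE⁻¹)ᵀ = D.massE⁻¹ := by
  rw [transpose_nonsing_inv, massE_transpose]

theorem massB_inv_transpose : (D.massB⁻¹)ᵀ = D.massB⁻¹ := by
  rw [transpose_nonsing_inv, massB_transpose]

/-! ### The splitting of the Hamiltonian -/

theorem hamiltonian_eq_sum (z : Phase N Ne Nb) :
    D.hamiltonian z = D.partHamiltonian .E z + D.partHamiltonian .B z
      + D.partHamiltonian (.v 0) z + D.partHamiltonian (.v 1) z + D.partHamiltonian (.v 2) z := by
  have h : ∑ s, D.weight s * (z.2.1 s ⬝ᵥ z.2.1 s) = ∑ s, D.weight s * z.2.1 s 0 ^ 2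
      + ∑ s, D.weight s * z.2.1 s 1 ^ 2 + ∑ s, D.weight s * z.2.1 s 2 ^ 2 := by
    rw [← Finset.sum_add_distrib, ← Finset.sum_add_distrib]
    refine Finset.sum_congr rfl fun s _ => ?_
    simp only [dotProduct, Fin.sum_univ_three]; ring
  simp only [hamiltonian, partHamiltonian, h]; ring

theorem contDiff_partHamiltonian (k : Part) : ContDiff ℝ ∞ (D.partHamiltonian k) := by
  cases k <;> unfold partHamiltonian <;> simp only [dotProduct, mulVec] <;> fun_prop

theorem fderiv_partHamiltonian_E (z u : Phase N Ne Nb) :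
    fderiv ℝ (D.partHamiltonian .E) z u = (D.massE *ᵥ z.2.2.1) ⬝ᵥ u.2.2.1 := by
  refine fderiv_eq_of_line ((D.contDiff_partHamiltonian _).differentiable (by simp) z)
    (hasDerivAt_quadratic (a := D.partHamiltonian .E z) (c := D.partHamiltonian .E u) fun τ => ?_)
  have h : z.2.2.1 ⬝ᵥ D.massE *ᵥ u.2.2.1 = u.2.2.1 ⬝ᵥ D.massE *ᵥ z.2.2.1 := by
    rw [dotProduct_mulVec, ← mulVec_transpose, massE_transpose, dotProduct_comm]
  simp only [partHamiltonian, Prod.snd_add, Prod.fst_add, Prod.smul_snd, Prod.smul_fst,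
    mulVec_add, mulVec_smul, dotProduct_add, add_dotProduct, smul_dotProduct, dotProduct_smul,
    smul_eq_mul, h, dotProduct_comm (D.massE *ᵥ z.2.2.1)]
  ring

theorem fderiv_partHamiltonian_B (z u : Phase N Ne Nb) :
    fderiv ℝ (D.partHamiltonian .B) z u = (D.massB *ᵥ z.2.2.2) ⬝ᵥ u.2.2.2 := by
  refine fderiv_eq_of_line ((D.contDiff_partHamiltonian _).differentiable (by simp) z)
    (hasDerivAt_quadratic (a := D.partHamiltonian .B z) (c := D.partHamiltonian .B u) fun τ => ?_)
  have h : z.2.2.2 ⬝ᵥ D.massB *ᵥ u.2.2.2 = u.2.2.2 ⬝ᵥ D.massB *ᵥ z.2.2.2 := by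
    rw [dotProduct_mulVec, ← mulVec_transpose, massB_transpose, dotProduct_comm]
  simp only [partHamiltonian, Prod.snd_add, Prod.smul_snd,
    mulVec_add, mulVec_smul, dotProduct_add, add_dotProduct, smul_dotProduct, dotProduct_smul,
    smul_eq_mul, h, dotProduct_comm (D.massB *ᵥ z.2.2.2)]
  ring

theorem fderiv_partHamiltonian_v (i : Fin 3) (z u : Phase N Ne Nb) :
    fderiv ℝ (D.partHamiltonian (.v i)) z u = ∑ s, D.weight s * z.2.1 s i * u.2.1 s i := by
  refine fderiv_eq_of_line ((D.contDiff_partHamiltonian _).differentiable (by simp) z)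
    (hasDerivAt_quadratic (a := D.partHamiltonian (.v i) z) (c := D.partHamiltonian (.v i) u)
      fun τ => ?_)
  simp only [partHamiltonian, Prod.snd_add, Prod.fst_add, Prod.smul_snd, Prod.smul_fst,
    Pi.add_apply, Pi.smul_apply, smul_eq_mul, Finset.mul_sum]
  rw [← Finset.sum_add_distrib, ← Finset.sum_add_distrib]
  refine Finset.sum_congr rfl fun s _ => ?_
  ring

variable {D} in
theorem bracket_add_right {F G K : Phase N Ne Nb → ℝ} {z : Phase N Ne Nb}
    (hG : DifferentiableAt ℝ G z) (hK : DifferentiableAt ℝ K z) :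
    D.bracket F (G + K) z = D.bracket F G z + D.bracket F K z := by
  have h := fderiv_add hG hK
  have hX : gradX (G + K) z = gradX G z + gradX K z := by ext; simp [gradX, h]
  have hV : gradV (G + K) z = gradV G z + gradV K z := by ext; simp [gradV, h]
  have hE : gradE (G + K) z = gradE G z + gradE K z := by ext; simp [gradE, h]
  have hB : gradB (G + K) z = gradB G z + gradB K z := by ext; simp [gradB, h]
  simp only [bracket, hX, hV, hE, hB, Pi.add_apply, map_add, mulVec_add, dotProduct_add,
    add_dotProduct, mul_add, mul_sub, Finset.sum_add_distrib, Finset.sum_sub_distrib]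
  ring

theorem field_eq_sum (z : Phase N Ne Nb) :
    D.field z = D.partField .E z + D.partField .B z
      + D.partField (.v 0) z + D.partField (.v 1) z + D.partField (.v 2) z := by
  have hv : ∀ v : Fin 3 → ℝ, v = v 0 • Pi.single 0 1 + v 1 • Pi.single 1 1 + v 2 • Pi.single 2 1 := by
    intro v; ext k; fin_cases k <;> simp
  refine Prod.ext ?_ (Prod.ext ?_ (Prod.ext ?_ ?_))
  · funext s
    simpa [field, partField] using hv (z.2.1 s)
  · funext s
    simp only [field, partField, Prod.snd_add, Prod.fst_add, Pi.add_apply, add_zero]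
    conv_lhs => rw [hv (z.2.1 s)]
    simp only [map_add, map_smul, LinearMap.add_apply, LinearMap.smul_apply]
    abel
  · simp only [field, partField, Prod.snd_add, Prod.fst_add, zero_add]
    have : ∑ s, D.weight s • D.sampleE (z.1 s) *ᵥ z.2.1 s
        = ∑ s, (D.weight s * z.2.1 s 0) • D.sampleE (z.1 s) *ᵥ Pi.single 0 1
        + ∑ s, (D.weight s * z.2.1 s 1) • D.sampleE (z.1 s) *ᵥ Pi.single 1 1
        + ∑ s, (D.weight s * z.2.1 s 2) • D.sampleE (z.1 s) *ᵥ Pi.single 2 1 := by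
      rw [← Finset.sum_add_distrib, ← Finset.sum_add_distrib]
      refine Finset.sum_congr rfl fun s _ => ?_
      conv_lhs => rw [hv (z.2.1 s)]
      simp only [mulVec_add, mulVec_smul, smul_add, smul_smul]
    rw [this, mulVec_sub, mulVec_add, mulVec_add]
    abel
  · simp [field, partField]

/-- Both sides depend on `F` only through `fderiv ℝ F z`, linearly, so no smoothness of `F` is
needed. The gradient of `H_E` is `massE *ᵥ E_D`, that of `H_B` is `massB *ᵥ B_D`, and that of `H_i`
carries the weight of each particle; these cancel the inverse factors of the bracket. -/
theorem bracket_partHamiltonian (hω : ∀ s, D.weight s ≠ 0) (hMe : IsUnit D.massE.det)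
    (hMb : IsUnit D.massB.det) (k : Part) (F : Phase N Ne Nb → ℝ) (z : Phase N Ne Nb) :
    D.bracket F (D.partHamiltonian k) z = fderiv ℝ F z (D.partField k z) := by
  rw [fderiv_apply_eq]
  cases k with
  | E =>
    have hX : gradX (D.partHamiltonian .E) z = 0 := by
      ext; simp [gradX, fderiv_partHamiltonian_E]
    have hV : gradV (D.partHamiltonian .E) z = 0 := by
      ext; simp [gradV, fderiv_partHamiltonian_E]
    have hE : gradE (D.partHamiltonian .E) z = D.massE *ᵥ z.2.2.1 := by
      ext; simp [gradE, fderiv_partHamiltonian_E]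
    have hB : gradB (D.partHamiltonian .E) z = 0 := by
      ext; simp [gradB, fderiv_partHamiltonian_E]
    have hM : ∀ {n : ℕ} (A : Matrix (Fin Ne) (Fin n) ℝ) (y : Fin n → ℝ),
        (D.massE *ᵥ z.2.2.1) ⬝ᵥ (D.massE⁻¹ * A) *ᵥ y = y ⬝ᵥ Aᵀ *ᵥ z.2.2.1 := by
      intro n A y
      rw [dotProduct_comm, ← mulVec_mulVec, dotProduct_comm, dotProduct_mulVec, ← mulVec_transpose,
        massE_inv_transpose, mulVec_mulVec, nonsing_inv_mul _ hMe, one_mulVec, dotProduct_mulVec,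
        ← mulVec_transpose, dotProduct_comm]
    simp only [bracket, hX, hV, hE, hB, partField, Matrix.mul_assoc, hM, Pi.zero_apply,
      mulVec_zero, dotProduct_zero, map_zero, zero_dotProduct]
    simp [transpose_mul, massB_inv_transpose, dotProduct_neg, mulVec_mulVec]
    ring
  | B =>
    have hX : gradX (D.partHamiltonian .B) z = 0 := by
      ext; simp [gradX, fderiv_partHamiltonian_B]
    have hV : gradV (D.partHamiltonian .B) z = 0 := by
      ext; simp [gradV, fderiv_partHamiltonian_B]
    have hE : gradE (D.partHamiltonian .B) z = 0 := by
      ext; simp [gradE, fderiv_partHamiltonian_B]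
    have hB : gradB (D.partHamiltonian .B) z = D.massB *ᵥ z.2.2.2 := by
      ext; simp [gradB, fderiv_partHamiltonian_B]
    simp [bracket, hX, hV, hE, hB, partField, mulVec_mulVec, Matrix.mul_assoc,
      nonsing_inv_mul _ hMb]
  | v i =>
    have hX : gradX (D.partHamiltonian (.v i)) z = 0 := by
      ext; simp [gradX, fderiv_partHamiltonian_v]
    have hV : ∀ s, gradV (D.partHamiltonian (.v i)) z s
        = (D.weight s * z.2.1 s i) • Pi.single i 1 := by
      intro s
      ext k
      simp only [gradV, fderiv_partHamiltonian_v]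
      rw [Finset.sum_eq_single s (by intro r _ hr; simp [hr]) (by simp)]
      simp [Pi.single_apply, eq_comm]
    have hE : gradE (D.partHamiltonian (.v i)) z = 0 := by
      ext; simp [gradE, fderiv_partHamiltonian_v]
    have hB : gradB (D.partHamiltonian (.v i)) z = 0 := by
      ext; simp [gradB, fderiv_partHamiltonian_v]
    simp only [bracket, hX, hV, hE, hB, partField, Pi.zero_apply, mulVec_zero, dotProduct_zero,
      zero_dotProduct, sub_zero, zero_sub, map_smul, mulVec_smul, dotProduct_smul, smul_eq_mul,
      add_zero, dotProduct_neg, mulVec_sum, dotProduct_sum, ← mulVec_mulVec,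
      Finset.sum_neg_distrib]
    rw [add_right_comm, ← Finset.sum_add_distrib, ← Finset.sum_add_distrib]
    congr 1
    refine Finset.sum_congr rfl fun s _ => ?_
    -- Cyclic permutation turns `B · (∂F/∂V × e_i)` into `∂F/∂V · (e_i × B)`, the magnetic force.
    have hc : ∀ b u w : Fin 3 → ℝ, b ⬝ᵥ crossProduct u w = u ⬝ᵥ crossProduct w b := by
      intro b u w; rw [triple_product_permutation]
    rw [dotProduct_mulVec, ← mulVec_transpose, hc]
    field_simp [hω s]

theorem bracket_hamiltonian (hω : ∀ s, D.weight s ≠ 0) (hMe : IsUnit D.massE.det)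
    (hMb : IsUnit D.massB.det) (F : Phase N Ne Nb → ℝ) (z : Phase N Ne Nb) :
    D.bracket F D.hamiltonian z = fderiv ℝ F z (D.field z) := by
  have hd : ∀ k, Differentiable ℝ (D.partHamiltonian k) := fun k =>
    (D.contDiff_partHamiltonian k).differentiable (by simp)
  have h : D.hamiltonian = D.partHamiltonian .E + D.partHamiltonian .B
      + D.partHamiltonian (.v 0) + D.partHamiltonian (.v 1) + D.partHamiltonian (.v 2) :=
    funext D.hamiltonian_eq_sum
  rw [h, bracket_add_right (((hd _).add (hd _)).add (hd _) |>.add (hd _) |>.differentiableAt)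
      (hd _).differentiableAt,
    bracket_add_right (((hd _).add (hd _)).add (hd _) |>.differentiableAt) (hd _).differentiableAt,
    bracket_add_right ((hd _).add (hd _)).differentiableAt (hd _).differentiableAt,
    bracket_add_right (hd _).differentiableAt (hd _).differentiableAt]
  simp only [D.bracket_partHamiltonian hω hMe hMb, field_eq_sum, map_add]

/-- Continuous linear functionals are admissible test functions, and the coordinates among them
already recover the full equation; the converse is the chain rule. -/
theorem solvesBracket_iff {H : Phase N Ne Nb → ℝ} {f : Phase N Ne Nb → Phase N Ne Nb}
    (hf : ∀ F z, D.bracket F H z = fderiv ℝ F z (f z)) (I : Set ℝ) (γ : ℝ → Phase N Ne Nb) :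
    D.SolvesBracket H I γ ↔ ∀ t ∈ I, HasDerivAt γ (f (γ t)) t := by
  constructor
  · intro h t ht
    have hL : ∀ L : Phase N Ne Nb →L[ℝ] ℝ, HasDerivAt (fun τ => L (γ τ)) (L (f (γ t))) t := by
      intro L
      have := h L L.contDiff t ht
      rwa [hf, L.fderiv] at this
    refine HasDerivAt.prodMk (hasDerivAt_pi.2 fun s => hasDerivAt_pi.2 fun k => ?_)
      (HasDerivAt.prodMk (hasDerivAt_pi.2 fun s => hasDerivAt_pi.2 fun k => ?_)
      (HasDerivAt.prodMk (hasDerivAt_pi.2 fun k => ?_) (hasDerivAt_pi.2 fun k => ?_)))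
    · exact hL (((ContinuousLinearMap.proj (R := ℝ) (φ := fun _ : Fin 3 => ℝ) k).comp
        (ContinuousLinearMap.proj (R := ℝ) (φ := fun _ : Fin N => Fin 3 → ℝ) s)).comp
        (ContinuousLinearMap.fst ℝ _ _))
    · exact hL (((ContinuousLinearMap.proj (R := ℝ) (φ := fun _ : Fin 3 => ℝ) k).comp
        (ContinuousLinearMap.proj (R := ℝ) (φ := fun _ : Fin N => Fin 3 → ℝ) s)).comp
        ((ContinuousLinearMap.fst ℝ _ _).comp (ContinuousLinearMap.snd ℝ _ _)))
    · exact hL ((ContinuousLinearMap.proj k).comp ((ContinuousLinearMap.fst ℝ _ _).comp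
        ((ContinuousLinearMap.snd ℝ _ _).comp (ContinuousLinearMap.snd ℝ _ _))))
    · exact hL ((ContinuousLinearMap.proj k).comp ((ContinuousLinearMap.snd ℝ _ _).comp
        ((ContinuousLinearMap.snd ℝ _ _).comp (ContinuousLinearMap.snd ℝ _ _))))
  · intro h F hF t ht
    rw [hf]
    exact ((hF.differentiable (by simp)) (γ t)).hasFDerivAt.comp_hasDerivAt t (h t ht)

end Discretisation

/-! ### Integrals depending smoothly on a parameter -/

section Parametric

variable {G : Type*} [NormedAddCommGroup G] [NormedSpace ℝ G] [FiniteDimensional ℝ G]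
  [MeasurableSpace G] [BorelSpace G] {μ : Measure G} {f : G → ℝ} {R : ℝ}

theorem integrable_mul_of_continuous (hf : Integrable f μ) (hR : ∀ᵐ x ∂μ, ‖x‖ ≤ R) {g : G → ℝ}
    (hg : Continuous g) : Integrable (fun x => f x * g x) μ := by
  obtain ⟨C, hC⟩ := (isCompact_closedBall (0 : G) R).exists_bound_of_continuousOn hg.continuousOn
  refine hf.mul_bdd (c := C) hg.aestronglyMeasurable ?_
  filter_upwards [hR] with x hx using hC x (by simpa using hx)

/-- As `μ` lives on a ball, `g` may be multiplied by a bump function that equals 1 there. After a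
reflection the integral is a convolution evaluated at the point 0, with a compactly supported smooth
kernel depending on a parameter, and such convolutions are smooth. -/
theorem contDiff_integral_mul {P : Type*} [NormedAddCommGroup P] [NormedSpace ℝ P]
    (hf : Integrable f μ) (hR : ∀ᵐ x ∂μ, ‖x‖ ≤ R) {g : P × G → ℝ} (hg : ContDiff ℝ ∞ g) :
    ContDiff ℝ ∞ fun p => ∫ x, f x * g (p, x) ∂μ := by
  -- `|R| + 1` rather than `R`, since the inner radius must be positive and `R` may have any sign.
  let χ : ContDiffBump (0 : G) := ⟨|R| + 1, |R| + 2, by positivity, by linarith⟩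
  have hχ : ∀ x, ‖x‖ ≤ R → χ x = 1 := fun x hx =>
    χ.one_of_mem_closedBall (by simpa using hx.trans ((le_abs_self R).trans (by simp [χ])))
  have key := contDiffOn_convolution_right_with_param (n := ⊤) (μ := μ) (f := f)
    (ContinuousLinearMap.mul ℝ ℝ) (g := fun (p : P) (y : G) => χ (-y) * g (p, -y))
    (s := Set.univ) (k := Metric.closedBall 0 (|R| + 2)) isOpen_univ (isCompact_closedBall _ _)
    (fun p x _ hx => by
      have : χ (-x) = 0 := χ.zero_of_le_dist (by
        simp only [Metric.mem_closedBall, dist_zero_right, not_le] at hx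
        simpa [χ] using hx.le)
      simp [this]) hf.locallyIntegrable
    (by
      refine ContDiff.contDiffOn ?_
      exact (χ.contDiff.comp contDiff_snd.neg).mul
        (hg.comp (contDiff_fst.prodMk contDiff_snd.neg)))
  rw [Set.univ_prod_univ, contDiffOn_univ] at key
  have := key.comp (contDiff_id.prodMk (contDiff_const (c := (0 : G))))
  convert this using 2 with p
  simp only [Function.comp, convolution, ContinuousLinearMap.mul_apply', zero_sub, neg_neg, id]
  refine integral_congr_ae ?_
  filter_upwards [hR] with x hx
  simp [hχ x hx]

theorem hasDerivAt_integral_mul (hf : Integrable f μ) (hR : ∀ᵐ x ∂μ, ‖x‖ ≤ R) {g : ℝ × G → ℝ}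
    (hg : ContDiff ℝ ∞ g) :
    HasDerivAt (fun τ => ∫ x, f x * g (τ, x) ∂μ) (∫ x, f x * fderiv ℝ g (0, x) (1, 0) ∂μ) 0 := by
  have hcont : Continuous fun q : ℝ × G => fderiv ℝ g q (1, 0) :=
    (hg.continuous_fderiv (by simp)).clm_apply continuous_const
  obtain ⟨C, hC⟩ := ((isCompact_closedBall (0 : ℝ) 1).prod
    (isCompact_closedBall (0 : G) R)).exists_bound_of_continuousOn hcont.continuousOn
  have hpair : ∀ τ : ℝ, Continuous fun x : G => (τ, x) := fun τ => by fun_prop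
  refine (hasDerivAt_integral_of_dominated_loc_of_deriv_le (bound := fun x => ‖f x‖ * C)
    (F' := fun τ x => f x * fderiv ℝ g (τ, x) (1, 0))
    (Metric.closedBall_mem_nhds 0 one_pos) (Eventually.of_forall fun τ =>
      (integrable_mul_of_continuous hf hR (hg.continuous.comp (hpair τ))).aestronglyMeasurable)
    (integrable_mul_of_continuous hf hR (hg.continuous.comp (hpair 0)))
    (integrable_mul_of_continuous hf hR (hcont.comp (hpair 0))).aestronglyMeasurable
    ?_ (hf.norm.mul_const C) ?_).2
  · filter_upwards [hR] with x hx τ hτ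
    rw [norm_mul]
    exact mul_le_mul_of_nonneg_left (hC (τ, x) ⟨hτ, by simpa using hx⟩) (norm_nonneg _)
  · refine Eventually.of_forall fun x τ _ => ?_
    have h1 : HasDerivAt (fun σ : ℝ => (σ, x)) ((1 : ℝ), (0 : G)) τ :=
      (hasDerivAt_id τ).prodMk (hasDerivAt_const τ x)
    exact (((hg.differentiable (by simp)) (τ, x)).hasFDerivAt.comp_hasDerivAt τ h1).const_mul _

end Parametric

/-! ### Integrals along coordinate segments -/

/-- The integral of `m` along the segment of signed length `d` that starts at `X` and points in
the `i`-th coordinate direction. -/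
def seg (m : (Fin 3 → ℝ) → ℝ) (i : Fin 3) (X : Fin 3 → ℝ) (d : ℝ) : ℝ :=
  ∫ θ in (0 : ℝ)..d, m (X + θ • Pi.single i 1)

/-- Translating the variable makes the limits `0` and `d`, so that the starting point enters only
through the integrand. -/
theorem lineIntegral_apply {n : ℕ} (M : (Fin 3 → ℝ) → Matrix (Fin n) (Fin 3) ℝ) (i : Fin 3)
    (X : Fin 3 → ℝ) (d : ℝ) (j : Fin n) (k : Fin 3) :
    Discretisation.lineIntegral M i X d j k = seg (fun Y => M Y j k) i X d := by
  have h := intervalIntegral.integral_comp_add_left (a := 0) (b := d)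
    (fun ξ => M (Function.update X i ξ) j k) (X i)
  simp only [add_zero] at h
  rw [Discretisation.lineIntegral, of_apply, ← h, seg]
  refine intervalIntegral.integral_congr fun θ _ => ?_
  have : Function.update X i (X i + θ) = X + θ • Pi.single i 1 := by
    ext a
    by_cases ha : a = i
    · subst ha; simp
    · simp [ha]
  simp only [this]

/-- Rescaling to the fixed interval `(0, 1]` turns `d` into a parameter of the integrand; the idle
factor 1 is the integrable function required by `contDiff_integral_mul`. -/
theorem seg_eq (m : (Fin 3 → ℝ) → ℝ) (i : Fin 3) (X : Fin 3 → ℝ) (d : ℝ) :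
    seg m i X d = d * ∫ θ in Set.Ioc (0 : ℝ) 1, 1 * m (X + (θ * d) • Pi.single i 1) := by
  have h := intervalIntegral.mul_integral_comp_mul_right (a := 0) (b := 1)
    (f := fun θ => m (X + θ • Pi.single i 1)) d
  simp only [zero_mul, one_mul] at h
  rw [seg, ← h, intervalIntegral.integral_of_le zero_le_one]
  simp

section Seg

variable {m : (Fin 3 → ℝ) → ℝ} (i : Fin 3) (X : Fin 3 → ℝ) (d : ℝ)

theorem integrable_one_Ioc : Integrable (fun _ : ℝ => (1 : ℝ)) (volume.restrict (Set.Ioc (0 : ℝ) 1)) :=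
  integrable_const _

theorem ae_norm_le_Ioc : ∀ᵐ θ ∂(volume.restrict (Set.Ioc (0 : ℝ) 1)), ‖θ‖ ≤ 1 := by
  filter_upwards [ae_restrict_mem measurableSet_Ioc] with θ hθ
  rw [Real.norm_eq_abs, abs_of_pos hθ.1]; exact hθ.2

theorem contDiff_seg (hm : ContDiff ℝ ∞ m) : ContDiff ℝ ∞ fun q : (Fin 3 → ℝ) × ℝ => seg m i q.1 q.2 := by
  simp only [seg_eq]
  refine contDiff_snd.mul (contDiff_integral_mul
    (g := fun r : ((Fin 3 → ℝ) × ℝ) × ℝ => m (r.1.1 + (r.2 * r.1.2) • Pi.single i 1))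
    integrable_one_Ioc ae_norm_le_Ioc ?_)
  exact hm.comp (by fun_prop)

theorem hasDerivAt_seg_line (hm : ContDiff ℝ ∞ m) (ξ : Fin 3 → ℝ) :
    HasDerivAt (fun τ : ℝ => seg m i (X + τ • ξ) d) (seg (fun Y => fderiv ℝ m Y ξ) i X d) 0 := by
  simp only [seg_eq]
  have hin : ContDiff ℝ ∞ fun r : ℝ × ℝ => X + r.1 • ξ + (r.2 * d) • (Pi.single i 1 : Fin 3 → ℝ) := by
    fun_prop
  have h := (hasDerivAt_integral_mul integrable_one_Ioc ae_norm_le_Ioc (hm.comp hin)).const_mul d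
  refine h.congr_deriv (congrArg (d * ·) (integral_congr_ae (Eventually.of_forall fun θ => ?_)))
  refine congrArg ((1 : ℝ) * ·) ?_
  refine fderiv_eq_of_line ((hm.comp hin).differentiable (by simp) _) ?_
  have h1 : HasDerivAt (fun τ : ℝ => X + τ • ξ + (θ * d) • (Pi.single i 1 : Fin 3 → ℝ)) ξ 0 := by
    simpa using (((hasDerivAt_id' (0 : ℝ)).smul_const ξ).const_add X).add_const
      ((θ * d) • (Pi.single i 1 : Fin 3 → ℝ))
  have h2 := (hm.differentiable (by simp) (X + (0 : ℝ) • ξ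
    + (θ * d) • (Pi.single i 1 : Fin 3 → ℝ))).hasFDerivAt.comp_hasDerivAt 0 h1
  simpa [Function.comp_def] using h2

theorem hasDerivAt_seg (hm : ContDiff ℝ ∞ m) : HasDerivAt (seg m i X) (m (X + d • Pi.single i 1)) d := by
  have hc : Continuous fun θ : ℝ => m (X + θ • Pi.single i 1) := hm.continuous.comp (by fun_prop)
  exact intervalIntegral.integral_hasDerivAt_right (hc.intervalIntegrable _ _)
    (hc.stronglyMeasurableAtFilter _ _) hc.continuousAt

theorem seg_fderiv_self (hm : ContDiff ℝ ∞ m) :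
    seg (fun Y => fderiv ℝ m Y (Pi.single i 1)) i X d = m (X + d • Pi.single i 1) - m X := by
  have hd : ∀ θ : ℝ, HasDerivAt (fun θ : ℝ => m (X + θ • Pi.single i 1))
      (fderiv ℝ m (X + θ • Pi.single i 1) (Pi.single i 1)) θ := fun θ => by
    have h1 : HasDerivAt (fun τ : ℝ => X + τ • (Pi.single i 1 : Fin 3 → ℝ)) (Pi.single i 1) θ := by
      simpa using ((hasDerivAt_id' θ).smul_const (Pi.single i 1 : Fin 3 → ℝ)).const_add X
    exact (hm.differentiable (by simp) _).hasFDerivAt.comp_hasDerivAt θ h1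
  have hc : Continuous fun θ : ℝ => fderiv ℝ m (X + θ • Pi.single i 1) (Pi.single i 1) :=
    ((hm.continuous_fderiv (by simp)).comp (by fun_prop)).clm_apply continuous_const
  rw [seg, intervalIntegral.integral_eq_sub_of_hasDerivAt (fun θ _ => hd θ)
    (hc.intervalIntegrable _ _)]
  simp

/-- The same segment run backwards; this makes the velocity substeps reversible. -/
theorem seg_neg : seg m i (X + d • Pi.single i 1) (-d) = -seg m i X d := by
  have h := intervalIntegral.integral_comp_add_left (a := 0) (b := -d)
    (fun θ => m (X + θ • Pi.single i 1)) d
  simp only [add_zero, add_neg_cancel] at h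
  rw [seg, seg, ← intervalIntegral.integral_symm, ← h]
  simp only [add_smul, add_assoc]

theorem seg_sum {n : ℕ} {w : Fin n → (Fin 3 → ℝ) → ℝ} (hw : ∀ j, Continuous (w j)) (b : Fin n → ℝ) :
    seg (fun Y => ∑ j, w j Y * b j) i X d = ∑ j, seg (w j) i X d * b j := by
  simp only [seg]
  rw [intervalIntegral.integral_finsetSum]
  · simp
  · intro j _
    exact Continuous.intervalIntegrable (((hw j).comp (by fun_prop)).mul continuous_const) _ _

end Seg

/-! ### Weak curl and weak divergence on a bounded open set -/

theorem partialDeriv_eq {φ : R3 → R3} {x : R3} (hφ : DifferentiableAt ℝ φ x) (a b : Fin 3) :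
    partialDeriv φ a b x = fderiv ℝ (fun y => φ y b) x (EuclideanSpace.single a 1) := by
  have := ((EuclideanSpace.proj (𝕜 := ℝ) b).hasFDerivAt.comp x hφ.hasFDerivAt).fderiv
  have h2 : (fun y => φ y b) = (EuclideanSpace.proj (𝕜 := ℝ) b) ∘ φ := rfl
  rw [h2, this]
  rfl

theorem gradient_apply (ψ : R3 → ℝ) (x : R3) (k : Fin 3) :
    gradient ψ x k = fderiv ℝ ψ x (EuclideanSpace.single k 1) := by
  have h := inner_gradient_left (𝕜 := ℝ) (f := ψ) (x := x) (y := EuclideanSpace.single k 1)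
  rw [← h, EuclideanSpace.inner_single_right]
  simp

theorem contDiff_gradient {ψ : R3 → ℝ} (hψ : ContDiff ℝ ∞ ψ) : ContDiff ℝ ∞ (gradient ψ) := by
  rw [contDiff_euclidean]
  intro k
  simp only [gradient_apply]
  exact (hψ.fderiv_right (m := ∞) (by simp)).clm_apply contDiff_const

theorem curl_gradient {ψ : R3 → ℝ} (hψ : ContDiff ℝ ∞ ψ) (x : R3) : curl (gradient ψ) x = 0 := by
  have hs : ∀ a b, partialDeriv (gradient ψ) a b x = partialDeriv (gradient ψ) b a x := by
    intro a b
    have hd := ((contDiff_gradient hψ).differentiable (by simp)) x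
    have hd2 : DifferentiableAt ℝ (fderiv ℝ ψ) x :=
      ((hψ.fderiv_right (m := ∞) (by simp)).differentiable (by simp)) x
    rw [partialDeriv_eq hd, partialDeriv_eq hd]
    simp only [gradient_apply]
    rw [fderiv_clm_apply hd2 (differentiableAt_const _),
      fderiv_clm_apply hd2 (differentiableAt_const _)]
    simp only [fderiv_fun_const, Pi.zero_apply, ContinuousLinearMap.comp_zero, zero_add,
      ContinuousLinearMap.flip_apply]
    exact (hψ.contDiffAt.isSymmSndFDerivAt (by simpa using WithTop.coe_le_coe.2 (le_top : (2 : ℕ∞) ≤ ⊤))) _ _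
  ext k
  fin_cases k
  · simp [curl, hs 1 2]
  · simp [curl, hs 2 0]
  · simp [curl, hs 0 1]

variable {Ω : Set R3}

theorem integrable_coord (hΩb : Bornology.IsBounded Ω) (F : L2Vec Ω) (k : Fin 3) :
    Integrable (fun x => F x k) (volume.restrict Ω) := by
  have : IsFiniteMeasure (volume.restrict Ω) := ⟨by
    rw [Measure.restrict_apply_univ]; exact hΩb.measure_lt_top⟩
  exact (EuclideanSpace.proj (𝕜 := ℝ) k).integrable_comp ((Lp.memLp F).integrable (by norm_num))

theorem exists_ae_norm_le (hΩ : IsOpen Ω) (hΩb : Bornology.IsBounded Ω) :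
    ∃ R : ℝ, ∀ᵐ x ∂(volume.restrict Ω), ‖x‖ ≤ R := by
  obtain ⟨R, hR⟩ := hΩb.exists_norm_le
  exact ⟨R, (ae_restrict_mem hΩ.measurableSet).mono fun x hx => hR x hx⟩

theorem integrable_coord_mul (hΩ : IsOpen Ω) (hΩb : Bornology.IsBounded Ω) (F : L2Vec Ω)
    (k : Fin 3) {g : R3 → ℝ} (hg : Continuous g) :
    Integrable (fun x => F x k * g x) (volume.restrict Ω) := by
  obtain ⟨R, hR⟩ := exists_ae_norm_le hΩ hΩb
  exact integrable_mul_of_continuous (integrable_coord hΩb F k) hR hg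

theorem integral_inner_eq (hΩ : IsOpen Ω) (hΩb : Bornology.IsBounded Ω) (F : L2Vec Ω)
    {φ : R3 → R3} (hφ : Continuous φ) :
    ∫ x in Ω, ⟪F x, φ x⟫_ℝ = ∑ k, ∫ x in Ω, F x k * φ x k := by
  rw [← integral_finsetSum]
  · refine integral_congr_ae (Eventually.of_forall fun x => ?_)
    simp [PiLp.inner_apply, mul_comm]
  · intro k _
    exact integrable_coord_mul hΩ hΩb F k (by fun_prop)

theorem integral_coord_add_smul (hΩ : IsOpen Ω) (hΩb : Bornology.IsBounded Ω) (F G : L2Vec Ω)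
    (c : ℝ) (k : Fin 3) {g : R3 → ℝ} (hg : Continuous g) :
    ∫ x in Ω, (F + c • G : L2Vec Ω) x k * g x
      = (∫ x in Ω, F x k * g x) + c * ∫ x in Ω, G x k * g x := by
  rw [← integral_const_mul, ← integral_add (integrable_coord_mul hΩ hΩb F k hg)
    ((integrable_coord_mul hΩ hΩb G k hg).const_mul c)]
  refine integral_congr_ae ?_
  filter_upwards [Lp.coeFn_add F (c • G), Lp.coeFn_smul c G] with x h1 h2
  rw [h1, Pi.add_apply, h2]
  simp only [Pi.smul_apply, PiLp.add_apply, PiLp.smul_apply, smul_eq_mul]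
  ring

theorem integral_zero_mul (ψ : R3 → ℝ) : ∫ x in Ω, (0 : L2Scal Ω) x * ψ x = 0 := by
  refine integral_eq_zero_of_ae ?_
  filter_upwards [Lp.coeFn_zero ℝ 2 (volume.restrict Ω)] with x hx
  rw [hx, Pi.zero_apply, zero_mul]

theorem IsWeakDiv.add_smul (hΩ : IsOpen Ω) (hΩb : Bornology.IsBounded Ω) {F G : L2Vec Ω}
    {g : L2Scal Ω} (hF : IsWeakDiv Ω F g) (hG : IsWeakDiv Ω G 0) (c : ℝ) :
    IsWeakDiv Ω (F + c • G) g := by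
  intro ψ hψ hc ht
  have hgc := (contDiff_gradient hψ).continuous
  have h2 := hG ψ hψ hc ht
  rw [integral_zero_mul, neg_zero, integral_inner_eq hΩ hΩb _ hgc] at h2
  rw [← hF ψ hψ hc ht, integral_inner_eq hΩ hΩb _ hgc, integral_inner_eq hΩ hΩb _ hgc]
  have hk : ∀ k, Continuous fun x => gradient ψ x k := fun k => by fun_prop
  simp only [integral_coord_add_smul hΩ hΩb F G c _ (hk _), Finset.sum_add_distrib,
    ← Finset.mul_sum, h2, mul_zero, add_zero]

/-- The gradient of a test function is an admissible test field for the weak curl, and its own curl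
vanishes. -/
theorem IsWeakCurl.isWeakDiv {F G : L2Vec Ω} (h : IsWeakCurl Ω F G) : IsWeakDiv Ω G 0 := by
  intro ψ hψ hc ht
  have hsub : Function.support (gradient ψ) ⊆ tsupport ψ := by
    intro x hx
    have : fderiv ℝ ψ x ≠ 0 := by
      intro h0
      apply hx
      ext k
      simp [gradient_apply, h0]
    exact support_fderiv_subset ℝ this
  have hts : tsupport (gradient ψ) ⊆ tsupport ψ := closure_minimal hsub (isClosed_tsupport _)
  rw [← h _ (contDiff_gradient hψ) (hc.of_isClosed_subset (isClosed_tsupport _) hts)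
    (hts.trans ht)]
  rw [integral_zero_mul]
  simp [curl_gradient hψ]

/-- `weakDiv` is an arbitrary choice among weak divergences, so its value has to be identified
through uniqueness, by the fundamental lemma of the calculus of variations. -/
theorem IsWeakDiv.weakDiv_ae_eq_zero (hΩ : IsOpen Ω) (hΩb : Bornology.IsBounded Ω) {F : L2Vec Ω}
    (h : IsWeakDiv Ω F 0) : ∀ᵐ x ∂(volume.restrict Ω), weakDiv Ω F x = 0 := by
  have : IsFiniteMeasure (volume.restrict Ω) := ⟨by
    rw [Measure.restrict_apply_univ]; exact hΩb.measure_lt_top⟩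
  have hex : ∃ g, IsWeakDiv Ω F g := ⟨0, h⟩
  have hw : IsWeakDiv Ω F (weakDiv Ω F) := by
    rw [weakDiv, dif_pos hex]; exact hex.choose_spec
  have hint : IntegrableOn (weakDiv Ω F) Ω volume :=
    (Lp.memLp (weakDiv Ω F)).integrable (by norm_num)
  rw [ae_restrict_iff' hΩ.measurableSet]
  refine hΩ.ae_eq_zero_of_integral_contDiff_smul_eq_zero hint.locallyIntegrableOn ?_
  intro ψ hψ hc ht
  have h1 := (h ψ hψ hc ht).symm.trans (hw ψ hψ hc ht)
  rw [integral_zero_mul] at h1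
  have h2 : ∫ x in Ω, weakDiv Ω F x * ψ x = 0 := by linarith
  rw [← h2, ← setIntegral_eq_integral_of_forall_compl_eq_zero (s := Ω)]
  · simp only [smul_eq_mul, mul_comm]
  · intro x hx
    have : ψ x = 0 := image_eq_zero_of_notMem_tsupport fun hx' => hx (ht hx')
    simp [this]

/-! ### Smoothing by the shape function -/

/-- The field `X ↦ ∫_Ω W(x) S(x - X) dx`. -/
def mollify (S : R3 → ℝ) (W : L2Vec Ω) (X : Fin 3 → ℝ) (k : Fin 3) : ℝ :=
  ∫ x in Ω, W x k * S (x - WithLp.toLp 2 X)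

variable {S : R3 → ℝ}

theorem contDiff_mollify (hΩ : IsOpen Ω) (hΩb : Bornology.IsBounded Ω) (hS : ContDiff ℝ ∞ S)
    (W : L2Vec Ω) (k : Fin 3) : ContDiff ℝ ∞ fun X => mollify S W X k := by
  obtain ⟨R, hR⟩ := exists_ae_norm_le hΩ hΩb
  refine contDiff_integral_mul (integrable_coord hΩb W k) hR
    (g := fun q : (Fin 3 → ℝ) × R3 => S (q.2 - WithLp.toLp 2 q.1)) ?_
  exact hS.comp (contDiff_snd.sub
    ((EuclideanSpace.equiv (Fin 3) ℝ).symm.contDiff.comp contDiff_fst))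

/-- The derivative falls on `S`, with a minus sign from `x - X`, so no regularity of `W` is
involved. -/
theorem fderiv_mollify (hΩ : IsOpen Ω) (hΩb : Bornology.IsBounded Ω) (hS : ContDiff ℝ ∞ S)
    (W : L2Vec Ω) (k a : Fin 3) (X : Fin 3 → ℝ) :
    fderiv ℝ (fun Y => mollify S W Y k) X (Pi.single a 1)
      = -∫ x in Ω, W x k * fderiv ℝ S (x - WithLp.toLp 2 X) (EuclideanSpace.single a 1) := by
  obtain ⟨R, hR⟩ := exists_ae_norm_le hΩ hΩb
  refine fderiv_eq_of_line ((contDiff_mollify hΩ hΩb hS W k).differentiable (by simp) X) ?_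
  have hg : ContDiff ℝ ∞ fun q : ℝ × R3 =>
      S (q.2 - (WithLp.toLp 2 X + q.1 • EuclideanSpace.single a (1 : ℝ))) :=
    hS.comp (by fun_prop)
  have h := hasDerivAt_integral_mul (integrable_coord hΩb W k) hR hg
  rw [← integral_neg]
  have hX : ∀ τ : ℝ, WithLp.toLp 2 (X + τ • Pi.single a 1)
      = WithLp.toLp 2 X + τ • EuclideanSpace.single a (1 : ℝ) := fun τ => rfl
  simp only [mollify, hX]
  refine h.congr_deriv (integral_congr_ae (Eventually.of_forall fun x => ?_))
  simp only [← mul_neg]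
  refine congrArg (W x k * ·) ?_
  refine fderiv_eq_of_line (hg.differentiable (by simp) _) ?_
  have h1 : HasDerivAt (fun τ : ℝ => x - (WithLp.toLp 2 X + τ • EuclideanSpace.single a (1 : ℝ)))
      (-EuclideanSpace.single a (1 : ℝ)) 0 := by
    simpa using (((hasDerivAt_id' (0 : ℝ)).smul_const
      (EuclideanSpace.single a (1 : ℝ))).const_add (WithLp.toLp 2 X)).const_sub x
  have h2 := (hS.differentiable (by simp) (x - (WithLp.toLp 2 X
    + (0 : ℝ) • EuclideanSpace.single a (1 : ℝ)))).hasFDerivAt.comp_hasDerivAt 0 h1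
  simpa [Function.comp_def] using h2

theorem mollify_sum {n : ℕ} (hΩ : IsOpen Ω) (hΩb : Bornology.IsBounded Ω) (hS : ContDiff ℝ ∞ S)
    (W : Fin n → L2Vec Ω) (c : Fin n → ℝ) (X : Fin 3 → ℝ) (k : Fin 3) :
    mollify S (∑ j, c j • W j) X k = ∑ j, c j * mollify S (W j) X k := by
  have hc : Continuous fun x => S (x - WithLp.toLp 2 X) := hS.continuous.comp (by fun_prop)
  have h0 : ∀ F G : L2Vec Ω, ∀ a : ℝ,
      mollify S (F + a • G) X k = mollify S F X k + a * mollify S G X k :=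
    fun F G a => integral_coord_add_smul hΩ hΩb F G a k hc
  let A : L2Vec Ω →ₗ[ℝ] ℝ :=
    { toFun := fun F => mollify S F X k
      map_add' := fun F G => by simpa using h0 F G 1
      map_smul' := fun a G => by
        have hz : mollify S (0 : L2Vec Ω) X k = 0 := by simpa using h0 0 0 1
        simpa [hz] using h0 0 G a }
  have := map_sum A (fun j => c j • W j) Finset.univ
  simp only [map_smul] at this
  exact this

/-- The curl of the smoothed field is the smoothed curl. -/
theorem curl_mollify (hΩ : IsOpen Ω) (hΩb : Bornology.IsBounded Ω) (hS : ContDiff ℝ ∞ S)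
    {F : L2Vec Ω} (hF : ZeroTangentialTrace Ω F) (X : Fin 3 → ℝ) :
    (fderiv ℝ (fun Y => mollify S F Y 2) X (Pi.single 1 1)
        - fderiv ℝ (fun Y => mollify S F Y 1) X (Pi.single 2 1) = mollify S (weakCurl Ω F) X 0) ∧
    (fderiv ℝ (fun Y => mollify S F Y 0) X (Pi.single 2 1)
        - fderiv ℝ (fun Y => mollify S F Y 2) X (Pi.single 0 1) = mollify S (weakCurl Ω F) X 1) ∧
    (fderiv ℝ (fun Y => mollify S F Y 1) X (Pi.single 0 1)
        - fderiv ℝ (fun Y => mollify S F Y 0) X (Pi.single 1 1) = mollify S (weakCurl Ω F) X 2) := by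
  set s : R3 → ℝ := fun x => S (x - WithLp.toLp 2 X) with hs
  have hsd : ContDiff ℝ ∞ s := hS.comp (by fun_prop)
  have hsf : ∀ x, fderiv ℝ s x = fderiv ℝ S (x - WithLp.toLp 2 X) := fun x => by
    exact fderiv_comp_sub _
  -- The test field is `S(· - X) e_c`. It need not vanish near the boundary, so the distributional
  -- curl alone would not do: the tangential trace condition is essential.
  have key : ∀ c : Fin 3, ∑ k, ∫ x in Ω, F x k * curl (fun y => s y • EuclideanSpace.single c 1) x k
      = mollify S (weakCurl Ω F) X c := by
    intro c
    have hφ : ContDiff ℝ ∞ fun y => s y • EuclideanSpace.single c (1 : ℝ) :=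
      hsd.smul contDiff_const
    have h := hF _ hφ
    have hcc : Continuous (curl fun y => s y • EuclideanSpace.single c (1 : ℝ)) := by
      have hp : ∀ a b, Continuous (partialDeriv (fun y => s y • EuclideanSpace.single c (1 : ℝ)) a b) := by
        intro a b
        have := (hφ.continuous_fderiv (by simp)).clm_apply
          (continuous_const (y := EuclideanSpace.single a (1 : ℝ)))
        exact (EuclideanSpace.proj (𝕜 := ℝ) b).continuous.comp this
      refine (PiLp.continuous_toLp 2 _).comp (continuous_pi fun k => ?_)
      fin_cases k <;> exact (hp _ _).sub (hp _ _)
    rw [integral_inner_eq hΩ hΩb _ hcc, integral_inner_eq hΩ hΩb _ hφ.continuous] at h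
    rw [h, Finset.sum_eq_single c]
    · simp [mollify, hs]
    · intro k _ hk
      simp [hk]
    · simp
  have hpd : ∀ a b c x, partialDeriv (fun y => s y • EuclideanSpace.single c (1 : ℝ)) a b x
      = if b = c then fderiv ℝ S (x - WithLp.toLp 2 X) (EuclideanSpace.single a 1) else 0 := by
    intro a b c x
    have hd : DifferentiableAt ℝ (fun y => s y • EuclideanSpace.single c (1 : ℝ)) x :=
      (hsd.smul contDiff_const).differentiable (by simp) x
    rw [partialDeriv_eq hd]
    by_cases hbc : b = c
    · subst hbc; simp [← hsf]
    · simp [hbc]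
  simp only [fderiv_mollify hΩ hΩb hS, ← key]
  refine ⟨?_, ?_, ?_⟩ <;>
  · simp [Fin.sum_univ_three, curl, hpd, integral_neg]
    try ring

/-- Smoothing keeps a field with vanishing normal trace divergence-free. -/
theorem div_mollify (hΩ : IsOpen Ω) (hΩb : Bornology.IsBounded Ω) (hS : ContDiff ℝ ∞ S)
    {F : L2Vec Ω} (hF : ZeroNormalTrace Ω F) (h0 : IsWeakDiv Ω F 0) (X : Fin 3 → ℝ) :
    ∑ a, fderiv ℝ (fun Y => mollify S F Y a) X (Pi.single a 1) = 0 := by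
  set s : R3 → ℝ := fun x => S (x - WithLp.toLp 2 X) with hs
  have hsd : ContDiff ℝ ∞ s := hS.comp (by fun_prop)
  have hsf : ∀ x, fderiv ℝ s x = fderiv ℝ S (x - WithLp.toLp 2 X) := fun x => by
    exact fderiv_comp_sub _
  -- The shifted shape function need not be supported in `Ω`; the normal trace condition still
  -- permits it as a test function.
  have h := hF s hsd
  have hz : ∫ x in Ω, weakDiv Ω F x * s x = 0 := by
    refine integral_eq_zero_of_ae ?_
    filter_upwards [h0.weakDiv_ae_eq_zero hΩ hΩb] with x hx
    simp [hx]
  rw [hz, integral_inner_eq hΩ hΩb _ (contDiff_gradient hsd).continuous] at h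
  simp only [fderiv_mollify hΩ hΩb hS, Finset.sum_neg_distrib, ← hsf, ← gradient_apply, h, neg_zero]

/-! ### Curl and divergence relations for the sampling matrices. -/

namespace Discretisation

variable {N Ne Nb : ℕ}

/-- The standing assumptions on the data of a discretisation. -/
structure Admissible (D : Discretisation N Ne Nb) : Prop where
  isOpen : IsOpen D.Ω
  isBounded : Bornology.IsBounded D.Ω
  smooth : ContDiff ℝ ∞ D.S
  weight_ne_zero : ∀ s, D.weight s ≠ 0
  linearIndependent_We : LinearIndependent ℝ D.We
  linearIndependent_Wb : LinearIndependent ℝ D.Wb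
  Eh_subset : (D.Eh : Set (L2Vec D.Ω)) ⊆ electricSpace D.Ω
  Bh_subset : (D.Bh : Set (L2Vec D.Ω)) ⊆ magneticSpace D.Ω
  curl_mem : ∀ F ∈ D.Eh, weakCurl D.Ω F ∈ D.Bh

variable {D : Discretisation N Ne Nb}

theorem sampleB_apply (X : Fin 3 → ℝ) (j : Fin Nb) (k : Fin 3) :
    D.sampleB X j k = mollify D.S (D.Wb j) X k := rfl

theorem sampleE_transpose_mulVec (X : Fin 3 → ℝ) (p : Fin Ne → ℝ) (k : Fin 3) :
    ((D.sampleE X)ᵀ *ᵥ p) k = ∑ j, D.sampleE X j k * p j := rfl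

theorem sampleB_transpose_mulVec (X : Fin 3 → ℝ) (q : Fin Nb → ℝ) (k : Fin 3) :
    ((D.sampleB X)ᵀ *ᵥ q) k = ∑ j, D.sampleB X j k * q j := rfl

theorem We_mem (j : Fin Ne) : D.We j ∈ D.Eh := Submodule.subset_span ⟨j, rfl⟩

theorem magneticField_mem (z : Phase N Ne Nb) : D.magneticField z ∈ D.Bh :=
  Submodule.sum_mem _ fun j _ => Submodule.smul_mem _ _ (Submodule.subset_span ⟨j, rfl⟩)

namespace Admissible

variable (hD : D.Admissible)

include hD

theorem isUnit_det_massE : IsUnit D.massE.det := D.isUnit_det_massE hD.linearIndependent_We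

theorem isUnit_det_massB : IsUnit D.massB.det := D.isUnit_det_massB hD.linearIndependent_Wb

theorem contDiff_sampleE (j : Fin Ne) (k : Fin 3) : ContDiff ℝ ∞ fun X => D.sampleE X j k :=
  contDiff_mollify hD.isOpen hD.isBounded hD.smooth (D.We j) k

theorem contDiff_sampleB (j : Fin Nb) (k : Fin 3) : ContDiff ℝ ∞ fun X => D.sampleB X j k :=
  contDiff_mollify hD.isOpen hD.isBounded hD.smooth (D.Wb j) k

theorem contDiff_sampleE_mulVec (p : Fin Ne → ℝ) (k : Fin 3) :
    ContDiff ℝ ∞ fun X => ((D.sampleE X)ᵀ *ᵥ p) k :=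
  ContDiff.sum (s := Finset.univ) (f := fun j X => D.sampleE X j k * p j)
    fun j _ => (hD.contDiff_sampleE j k).mul contDiff_const

theorem contDiff_sampleB_mulVec (q : Fin Nb → ℝ) (k : Fin 3) :
    ContDiff ℝ ∞ fun X => ((D.sampleB X)ᵀ *ᵥ q) k :=
  ContDiff.sum (s := Finset.univ) (f := fun j X => D.sampleB X j k * q j)
    fun j _ => (hD.contDiff_sampleB j k).mul contDiff_const

/-- The curls of the electric basis functions in the magnetic basis. -/
theorem weakCurl_We (i : Fin Ne) :
    weakCurl D.Ω (D.We i) = ∑ j, (D.curlMatrix * D.massB⁻¹) i j • D.Wb j := by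
  have h := hD.curl_mem _ (We_mem i)
  rw [Bh, Submodule.mem_span_range_iff_exists_fun] at h
  obtain ⟨c, hc⟩ := h
  -- Pairing the expansion of the curl with the magnetic basis gives a row of `curlMatrix`;
  -- inverting `massB` recovers the coefficients.
  have hK : D.curlMatrix i = c ᵥ* D.massB := by
    ext l
    rw [curlMatrix, of_apply, ← hc, sum_inner]
    simp [vecMul, dotProduct, massB, real_inner_smul_left]
  have h2 : (D.curlMatrix * D.massB⁻¹) i = c := by
    rw [mul_apply_eq_vecMul, hK, vecMul_vecMul, mul_nonsing_inv _ hD.isUnit_det_massB, vecMul_one]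
  rw [h2, hc]

theorem fderiv_sampleE_mulVec (p : Fin Ne → ℝ) (X ξ : Fin 3 → ℝ) (b : Fin 3) :
    fderiv ℝ (fun Y => ((D.sampleE Y)ᵀ *ᵥ p) b) X ξ
      = ∑ j, fderiv ℝ (fun Y => D.sampleE Y j b) X ξ * p j := by
  have hd : ∀ j, DifferentiableAt ℝ (fun Y => D.sampleE Y j b) X := fun j =>
    (hD.contDiff_sampleE j b).differentiable (by simp) X
  simp only [sampleE_transpose_mulVec]
  rw [fderiv_fun_sum fun j _ => (hd j).mul_const _]
  rw [_root_.sum_apply]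
  refine Finset.sum_congr rfl fun j _ => ?_
  rw [fderiv_mul_const (hd j), _root_.smul_apply, smul_eq_mul, mul_comm]

theorem mollify_weakCurl_We (p : Fin Ne → ℝ) (X : Fin 3 → ℝ) (c : Fin 3) :
    ∑ i, mollify D.S (weakCurl D.Ω (D.We i)) X c * p i
      = ((D.sampleB X)ᵀ *ᵥ D.massB⁻¹ *ᵥ D.curlMatrixᵀ *ᵥ p) c := by
  simp only [hD.weakCurl_We, mollify_sum hD.isOpen hD.isBounded hD.smooth, ← sampleB_apply]
  have h : D.massB⁻¹ * D.curlMatrixᵀ = (D.curlMatrix * D.massB⁻¹)ᵀ := by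
    rw [transpose_mul, massB_inv_transpose]
  rw [mulVec_mulVec p D.massB⁻¹, h, sampleB_transpose_mulVec]
  simp only [mulVec, dotProduct, transpose_apply, Finset.mul_sum, Finset.sum_mul]
  rw [Finset.sum_comm]
  refine Finset.sum_congr rfl fun j _ => Finset.sum_congr rfl fun i _ => ?_
  ring

/-- Smoothing commutes with the curl, and `massB⁻¹ curlMatrixᵀ p` holds the magnetic coefficients of
the curl of `∑ p_j W_j^e`. This is the discrete Faraday law as seen by the particles. -/
theorem curl_sampleE (p : Fin Ne → ℝ) (X : Fin 3 → ℝ) :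
    (fderiv ℝ (fun Y => ((D.sampleE Y)ᵀ *ᵥ p) 2) X (Pi.single 1 1)
        - fderiv ℝ (fun Y => ((D.sampleE Y)ᵀ *ᵥ p) 1) X (Pi.single 2 1)
      = ((D.sampleB X)ᵀ *ᵥ D.massB⁻¹ *ᵥ D.curlMatrixᵀ *ᵥ p) 0) ∧
    (fderiv ℝ (fun Y => ((D.sampleE Y)ᵀ *ᵥ p) 0) X (Pi.single 2 1)
        - fderiv ℝ (fun Y => ((D.sampleE Y)ᵀ *ᵥ p) 2) X (Pi.single 0 1)
      = ((D.sampleB X)ᵀ *ᵥ D.massB⁻¹ *ᵥ D.curlMatrixᵀ *ᵥ p) 1) ∧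
    (fderiv ℝ (fun Y => ((D.sampleE Y)ᵀ *ᵥ p) 1) X (Pi.single 0 1)
        - fderiv ℝ (fun Y => ((D.sampleE Y)ᵀ *ᵥ p) 0) X (Pi.single 1 1)
      = ((D.sampleB X)ᵀ *ᵥ D.massB⁻¹ *ᵥ D.curlMatrixᵀ *ᵥ p) 2) := by
  have h := fun i => curl_mollify hD.isOpen hD.isBounded hD.smooth
    (hD.Eh_subset (We_mem i)).2 X
  simp only [hD.fderiv_sampleE_mulVec, ← Finset.sum_sub_distrib, ← sub_mul,
    ← hD.mollify_weakCurl_We]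
  exact ⟨Finset.sum_congr rfl fun i _ => congrArg (· * p i) (h i).1,
    Finset.sum_congr rfl fun i _ => congrArg (· * p i) (h i).2.1,
    Finset.sum_congr rfl fun i _ => congrArg (· * p i) (h i).2.2⟩

/-- Sampling the basis and contracting with `B_D` is smoothing the field `B_h` itself. Through this
relation the constraint `∇·B_h = 0` enters the particle computation of `bracket_flow_v`. -/
theorem div_sampleB {z : Phase N Ne Nb} (hz : IsWeakDiv D.Ω (D.magneticField z) 0)
    (X : Fin 3 → ℝ) :
    ∑ a, fderiv ℝ (fun Y => ((D.sampleB Y)ᵀ *ᵥ z.2.2.2) a) X (Pi.single a 1) = 0 := by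
  have h := div_mollify hD.isOpen hD.isBounded hD.smooth
    (hD.Bh_subset (magneticField_mem z)).2 hz X
  have hf : ∀ a, (fun Y => ((D.sampleB Y)ᵀ *ᵥ z.2.2.2) a)
      = fun Y => mollify D.S (D.magneticField z) Y a := by
    intro a
    ext Y
    rw [magneticField, mollify_sum hD.isOpen hD.isBounded hD.smooth, sampleB_transpose_mulVec]
    exact Finset.sum_congr rfl fun j _ => mul_comm _ _
  simpa only [hf] using h

/-! ### The divergence of the magnetic field -/

theorem isWeakDiv_weakCurl_We (i : Fin Ne) : IsWeakDiv D.Ω (weakCurl D.Ω (D.We i)) 0 := by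
  have hex := (hD.Eh_subset (We_mem i)).1
  have : IsWeakCurl D.Ω (D.We i) (weakCurl D.Ω (D.We i)) := by
    rw [weakCurl, dif_pos hex]; exact hex.choose_spec
  exact this.isWeakDiv

theorem magneticField_flow_E (t : ℝ) (z : Phase N Ne Nb) :
    D.magneticField (D.flow .E t z)
      = D.magneticField z + (-t) • ∑ i, z.2.2.1 i • weakCurl D.Ω (D.We i) := by
  have h : D.massB⁻¹ * D.curlMatrixᵀ = (D.curlMatrix * D.massB⁻¹)ᵀ := by
    rw [transpose_mul, massB_inv_transpose]
  simp only [magneticField, flow, hD.weakCurl_We, mulVec_mulVec, h, Pi.sub_apply, sub_smul,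
    Finset.sum_sub_distrib, neg_smul, ← sub_eq_add_neg, Pi.smul_apply, smul_eq_mul]
  refine congrArg _ ?_
  simp only [Finset.smul_sum, mulVec, dotProduct, transpose_apply, Finset.mul_sum, Finset.sum_smul,
    smul_smul]
  rw [Finset.sum_comm]
  refine Finset.sum_congr rfl fun j _ => Finset.sum_congr rfl fun i _ => ?_
  congr 1; ring

/-- Only the `E` substep alters `B_D`, and it adds a combination of weak curls. -/
theorem isWeakDiv_flow_of (k : Part) (t : ℝ) (z : Phase N Ne Nb) (g : L2Scal D.Ω)
    (h : IsWeakDiv D.Ω (D.magneticField z) g) :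
    IsWeakDiv D.Ω (D.magneticField (D.flow k t z)) g := by
  cases k with
  | E =>
    rw [hD.magneticField_flow_E]
    refine h.add_smul hD.isOpen hD.isBounded ?_ _
    refine Finset.sum_induction _ (fun F => IsWeakDiv D.Ω F 0) ?_ ?_ ?_
    · intro F G hF hG
      simpa using hF.add_smul hD.isOpen hD.isBounded hG 1
    · intro ψ _ _ _
      rw [integral_zero_mul, integral_eq_zero_of_ae, neg_zero]
      filter_upwards [Lp.coeFn_zero R3 2 (volume.restrict D.Ω)] with x hx
      rw [hx]; simp
    · intro i _
      have h0 : IsWeakDiv D.Ω (0 : L2Vec D.Ω) 0 := by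
        intro ψ _ _ _
        rw [integral_zero_mul, integral_eq_zero_of_ae, neg_zero]
        filter_upwards [Lp.coeFn_zero R3 2 (volume.restrict D.Ω)] with x hx
        rw [hx]; simp
      simpa using h0.add_smul hD.isOpen hD.isBounded (hD.isWeakDiv_weakCurl_We i) (z.2.2.1 i)
  | B => exact h
  | v i => exact h

end Admissible

end Discretisation

/-! ### Smoothness of the subsystems and of their update maps -/

section Calculus

variable {E : Type*} [NormedAddCommGroup E] [NormedSpace ℝ E]

theorem contDiff_mulVec {m n : ℕ} {A : E → Matrix (Fin m) (Fin n) ℝ} {v : E → Fin n → ℝ}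
    (hA : ∀ i j, ContDiff ℝ ∞ fun x => A x i j) (hv : ContDiff ℝ ∞ v) :
    ContDiff ℝ ∞ fun x => A x *ᵥ v x :=
  contDiff_pi.2 fun i => ContDiff.sum (s := Finset.univ) (f := fun j x => A x i j * v x j)
    fun j _ => (hA i j).mul (contDiff_pi.1 hv j)

theorem contDiff_crossProduct (u : Fin 3 → ℝ) {v : E → Fin 3 → ℝ} (hv : ContDiff ℝ ∞ v) :
    ContDiff ℝ ∞ fun x => crossProduct u (v x) :=
  (LinearMap.toContinuousLinearMap (crossProduct u)).contDiff.comp hv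

theorem HasDerivAt.linearMap_comp {m n : ℕ} (A : (Fin m → ℝ) →ₗ[ℝ] (Fin n → ℝ))
    {v : ℝ → Fin m → ℝ} {v' : Fin m → ℝ} {t : ℝ} (hv : HasDerivAt v v' t) :
    HasDerivAt (fun τ => A (v τ)) (A v') t :=
  (LinearMap.toContinuousLinearMap A).hasFDerivAt.comp_hasDerivAt t hv

theorem hasDerivAt_fst {F : Type*} [NormedAddCommGroup F] [NormedSpace ℝ F] {f : ℝ → E × F}
    {f' : E × F} {t : ℝ} (h : HasDerivAt f f' t) : HasDerivAt (fun τ => (f τ).1) f'.1 t :=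
  (ContinuousLinearMap.fst ℝ E F).hasFDerivAt.comp_hasDerivAt t h

theorem hasDerivAt_snd {F : Type*} [NormedAddCommGroup F] [NormedSpace ℝ F] {f : ℝ → E × F}
    {f' : E × F} {t : ℝ} (h : HasDerivAt f f' t) : HasDerivAt (fun τ => (f τ).2) f'.2 t :=
  (ContinuousLinearMap.snd ℝ E F).hasFDerivAt.comp_hasDerivAt t h

/-- `f'` may be written in terms of `f`; once a right-hand side is known along the curve, this is
all the uniqueness theory required. -/
theorem eqOn_of_hasDerivAt {I : Set ℝ} (hI : IsOpen I) (hc : I.OrdConnected) {x₀ : ℝ} (hx : x₀ ∈ I)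
    {f g f' : ℝ → E} (hf : ∀ t ∈ I, HasDerivAt f (f' t) t) (hg : ∀ t ∈ I, HasDerivAt g (f' t) t)
    (h : f x₀ = g x₀) : ∀ t ∈ I, f t = g t :=
  hI.eqOn_of_deriv_eq hc.isPreconnected
    (fun t ht => (hf t ht).differentiableAt.differentiableWithinAt)
    (fun t ht => (hg t ht).differentiableAt.differentiableWithinAt)
    (fun t ht => by rw [(hf t ht).deriv, (hg t ht).deriv]) hx h

end Calculus

namespace Discretisation

variable {N Ne Nb : ℕ} {D : Discretisation N Ne Nb}

namespace Admissible

variable (hD : D.Admissible)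

include hD

theorem lineIntegral_sampleB_mulVec (i : Fin 3) (X : Fin 3 → ℝ) (d : ℝ) (q : Fin Nb → ℝ)
    (k : Fin 3) : ((lineIntegral D.sampleB i X d)ᵀ *ᵥ q) k
      = seg (fun Y => ((D.sampleB Y)ᵀ *ᵥ q) k) i X d := by
  simp only [sampleB_transpose_mulVec]
  rw [seg_sum i X d fun j => (hD.contDiff_sampleB j k).continuous]
  simp only [mulVec, dotProduct, transpose_apply, lineIntegral_apply]

theorem contDiff_partField (k : Part) : ContDiff ℝ ∞ (D.partField k) := by
  have hE : ∀ s j k, ContDiff ℝ ∞ fun z : Phase N Ne Nb => D.sampleE (z.1 s) j k := fun s j k =>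
    (hD.contDiff_sampleE j k).comp (by fun_prop)
  have hB : ∀ s j k, ContDiff ℝ ∞ fun z : Phase N Ne Nb => D.sampleB (z.1 s) j k := fun s j k =>
    (hD.contDiff_sampleB j k).comp (by fun_prop)
  cases k with
  | E =>
    refine contDiff_const.prodMk ((contDiff_pi.2 fun s => contDiff_mulVec (fun i j => hE s j i)
      (by fun_prop)).prodMk (contDiff_const.prodMk (ContDiff.neg ?_)))
    exact contDiff_mulVec (fun _ _ => contDiff_const) (contDiff_mulVec (fun _ _ => contDiff_const)
      (by fun_prop))
  | B =>
    refine contDiff_const.prodMk (contDiff_const.prodMk (ContDiff.prodMk ?_ contDiff_const))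
    exact contDiff_mulVec (fun _ _ => contDiff_const) (contDiff_mulVec (fun _ _ => contDiff_const)
      (by fun_prop))
  | v i =>
    refine ContDiff.prodMk (contDiff_pi.2 fun s => ContDiff.fun_smul (by fun_prop) contDiff_const)
      ((contDiff_pi.2 fun s => ContDiff.fun_smul (by fun_prop) (contDiff_crossProduct _
        (contDiff_mulVec (fun i j => hB s j i) (by fun_prop)))).prodMk
      (ContDiff.prodMk (ContDiff.neg (contDiff_mulVec (fun _ _ => contDiff_const)
        (ContDiff.sum fun s _ => ContDiff.fun_smul (by fun_prop)
          (contDiff_mulVec (hE s) contDiff_const)))) contDiff_const))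

theorem contDiff_field : ContDiff ℝ ∞ D.field := by
  rw [funext D.field_eq_sum]
  exact ((((hD.contDiff_partField _).add (hD.contDiff_partField _)).add
    (hD.contDiff_partField _)).add (hD.contDiff_partField _)).add (hD.contDiff_partField _)

/-- Joint smoothness in time and state provides remainder estimates uniform in the starting point.
-/
theorem contDiff_uncurry_flow (k : Part) :
    ContDiff ℝ ∞ fun q : ℝ × Phase N Ne Nb => D.flow k q.1 q.2 := by
  have hE : ∀ s j k, ContDiff ℝ ∞ fun q : ℝ × Phase N Ne Nb => D.sampleE (q.2.1 s) j k :=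
    fun s j k => (hD.contDiff_sampleE j k).comp (by fun_prop)
  have hLE : ∀ i s j k, ContDiff ℝ ∞ fun q : ℝ × Phase N Ne Nb =>
      lineIntegral D.sampleE i (q.2.1 s) (q.1 * q.2.2.1 s i) j k := fun i s j k => by
    simp only [lineIntegral_apply]
    exact (contDiff_seg i (hD.contDiff_sampleE j k)).comp
      (g := fun r : (Fin 3 → ℝ) × ℝ => seg (fun Y => D.sampleE Y j k) i r.1 r.2)
      (f := fun q : ℝ × Phase N Ne Nb => (q.2.1 s, q.1 * q.2.2.1 s i)) (by fun_prop)
  have hLB : ∀ i s j k, ContDiff ℝ ∞ fun q : ℝ × Phase N Ne Nb =>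
      lineIntegral D.sampleB i (q.2.1 s) (q.1 * q.2.2.1 s i) j k := fun i s j k => by
    simp only [lineIntegral_apply]
    exact (contDiff_seg i (hD.contDiff_sampleB j k)).comp
      (g := fun r : (Fin 3 → ℝ) × ℝ => seg (fun Y => D.sampleB Y j k) i r.1 r.2)
      (f := fun q : ℝ × Phase N Ne Nb => (q.2.1 s, q.1 * q.2.2.1 s i)) (by fun_prop)
  cases k with
  | E =>
    refine ContDiff.prodMk (by fun_prop) ((contDiff_pi.2 fun s => ContDiff.add (by fun_prop)
      (contDiff_fst.smul (contDiff_mulVec (fun i j => hE s j i) (by fun_prop)))).prodMk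
      (ContDiff.prodMk (by fun_prop) (ContDiff.sub (by fun_prop) (contDiff_fst.smul ?_))))
    exact contDiff_mulVec (fun _ _ => contDiff_const) (contDiff_mulVec (fun _ _ => contDiff_const)
      (by fun_prop))
  | B =>
    refine ContDiff.prodMk (by fun_prop) (ContDiff.prodMk (by fun_prop)
      (ContDiff.prodMk (ContDiff.add (by fun_prop) (contDiff_fst.smul ?_)) (by fun_prop)))
    exact contDiff_mulVec (fun _ _ => contDiff_const) (contDiff_mulVec (fun _ _ => contDiff_const)
      (by fun_prop))
  | v i =>
    refine ContDiff.prodMk (contDiff_pi.2 fun s => ContDiff.add (by fun_prop)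
        (ContDiff.fun_smul (by fun_prop) contDiff_const))
      ((contDiff_pi.2 fun s => ContDiff.add (by fun_prop) (contDiff_crossProduct _
        (contDiff_mulVec (fun a b => hLB i s b a) (by fun_prop)))).prodMk
      (ContDiff.prodMk (ContDiff.sub (by fun_prop) (contDiff_mulVec (fun _ _ => contDiff_const)
        (ContDiff.sum fun s _ => contDiff_const.fun_smul
          (contDiff_mulVec (hLE i s) contDiff_const)))) (by fun_prop)))

theorem contDiff_flow (k : Part) (t : ℝ) : ContDiff ℝ ∞ (D.flow k t) :=
  (hD.contDiff_uncurry_flow k).comp (f := fun z : Phase N Ne Nb => (t, z)) (by fun_prop)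

theorem contDiff_compose (l : List (Part × ℝ)) : ContDiff ℝ ∞ (D.compose l) := by
  induction l with
  | nil => exact contDiff_id
  | cons a l ih => exact (hD.contDiff_flow a.1 a.2).comp ih

/-! ### The update maps are the exact flows of the subsystems -/

omit hD in
theorem flow_zero (k : Part) (z : Phase N Ne Nb) : D.flow k 0 z = z := by
  have h0 : ∀ {n : ℕ} (M : (Fin 3 → ℝ) → Matrix (Fin n) (Fin 3) ℝ) i X,
      lineIntegral M i X 0 = 0 := by
    intro n M i X; ext j k; simp [lineIntegral]
  cases k <;> simp only [flow, h0, zero_mul, zero_smul, add_zero, sub_zero, transpose_zero,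
    zero_mulVec, map_zero, smul_zero, Finset.sum_const_zero, mulVec_zero]

omit hD in
-- `e_i × w` is orthogonal to `e_i`, so the magnetic kick leaves this component alone.
theorem flow_v_velocity (i : Fin 3) (t : ℝ) (z : Phase N Ne Nb) (s : Fin N) :
    (D.flow (.v i) t z).2.1 s i = z.2.1 s i := by
  simp only [flow, Pi.add_apply]
  fin_cases i <;> simp [cross_apply]

theorem hasDerivAt_lineIntegral_sampleE (i : Fin 3) (X : Fin 3 → ℝ) (v t : ℝ) :
    HasDerivAt (fun τ : ℝ => lineIntegral D.sampleE i X (τ * v) *ᵥ Pi.single i 1)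
      (v • D.sampleE (X + (t * v) • Pi.single i 1) *ᵥ Pi.single i 1) t := by
  refine hasDerivAt_pi.2 fun j => ?_
  simp only [mulVec_single_one, Matrix.col_apply, lineIntegral_apply, Pi.smul_apply, smul_eq_mul]
  have h := (hasDerivAt_seg i X (t * v) (hD.contDiff_sampleE j i)).comp t
    ((hasDerivAt_id' t).mul_const v)
  exact h.congr_deriv (by ring)

theorem hasDerivAt_lineIntegral_sampleB (i : Fin 3) (X : Fin 3 → ℝ) (v t : ℝ) (q : Fin Nb → ℝ) :
    HasDerivAt (fun τ : ℝ => (lineIntegral D.sampleB i X (τ * v))ᵀ *ᵥ q)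
      (v • (D.sampleB (X + (t * v) • Pi.single i 1))ᵀ *ᵥ q) t := by
  refine hasDerivAt_pi.2 fun k => ?_
  simp only [hD.lineIntegral_sampleB_mulVec, Pi.smul_apply, smul_eq_mul]
  have h := (hasDerivAt_seg i X (t * v) (hD.contDiff_sampleB_mulVec q k)).comp t
    ((hasDerivAt_id' t).mul_const v)
  exact h.congr_deriv (by ring)

theorem hasDerivAt_flow (k : Part) (z : Phase N Ne Nb) (t : ℝ) :
    HasDerivAt (fun τ => D.flow k τ z) (D.partField k (D.flow k t z)) t := by
  cases k with
  | E =>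
    refine (hasDerivAt_const t _).prodMk ((hasDerivAt_pi.2 fun s => ?_).prodMk
      ((hasDerivAt_const t _).prodMk ?_))
    · exact (((hasDerivAt_id' t).smul_const _).const_add (z.2.1 s)).congr_deriv (one_smul _ _)
    · exact (((hasDerivAt_id' t).smul_const _).const_sub z.2.2.2).congr_deriv
        (congrArg _ (one_smul _ _))
  | B =>
    refine (hasDerivAt_const t _).prodMk ((hasDerivAt_const t _).prodMk
      (HasDerivAt.prodMk ?_ (hasDerivAt_const t _)))
    exact (((hasDerivAt_id' t).smul_const _).const_add z.2.2.1).congr_deriv (one_smul _ _)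
  | v i =>
    have hv := fun s => flow_v_velocity (D := D) i t z s
    refine HasDerivAt.prodMk (hasDerivAt_pi.2 fun s => ?_) ((hasDerivAt_pi.2 fun s => ?_).prodMk
      (HasDerivAt.prodMk ?_ (hasDerivAt_const t _)))
    · have h := (((hasDerivAt_id' t).mul_const (z.2.1 s i)).smul_const
        (Pi.single i 1 : Fin 3 → ℝ)).const_add (z.1 s)
      refine h.congr_deriv ?_
      rw [hv, one_mul]
    · have h := (HasDerivAt.linearMap_comp (crossProduct (Pi.single i 1))
        (hD.hasDerivAt_lineIntegral_sampleB i (z.1 s) (z.2.1 s i) t z.2.2.2)).const_add (z.2.1 s)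
      refine h.congr_deriv ?_
      rw [hv, map_smul]
      rfl
    · have h := (HasDerivAt.linearMap_comp (D.massE⁻¹.mulVecLin)
        (HasDerivAt.fun_sum (u := Finset.univ) fun s _ =>
          (hD.hasDerivAt_lineIntegral_sampleE i (z.1 s) (z.2.1 s i) t).const_smul
            (D.weight s))).const_sub z.2.2.1
      refine h.congr_deriv ?_
      simp only [hv, smul_smul, mulVecLin_apply]
      rfl

/-- The subsystems are triangular. In the `E` case `X` and `E_D` are constant, in the `B` case `B_D`
is; in a velocity case `B_D` and `V_s[i]` are constant, hence `X` is determined, and then everything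
else. This works on any open interval, without a Lipschitz argument. -/
theorem eq_flow_iff (k : Part) (z : Phase N Ne Nb) {I : Set ℝ} {γ : ℝ → Phase N Ne Nb}
    (hI : IsOpen I) (hc : I.OrdConnected) (h0 : (0 : ℝ) ∈ I) :
    (γ 0 = z ∧ ∀ t ∈ I, HasDerivAt γ (D.partField k (γ t)) t) ↔ ∀ t ∈ I, γ t = D.flow k t z := by
  constructor
  · rintro ⟨hz, hγ⟩
    -- It suffices that the vector field takes equal values along both curves, and these values
    -- involve only the components identified in advance.
    have key : (∀ t ∈ I, D.partField k (γ t) = D.partField k (D.flow k t z)) →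
        ∀ t ∈ I, γ t = D.flow k t z := fun hk =>
      eqOn_of_hasDerivAt hI hc h0 (f' := fun t => D.partField k (γ t)) hγ
        (fun t ht => by rw [hk t ht]; exact hD.hasDerivAt_flow k z t) (by rw [hz, flow_zero])
    have hfst : ∀ t ∈ I, HasDerivAt (fun τ => (γ τ).1) (D.partField k (γ t)).1 t := fun t ht =>
      hasDerivAt_fst (hγ t ht)
    have hV : ∀ t ∈ I, HasDerivAt (fun τ => (γ τ).2.1) (D.partField k (γ t)).2.1 t := fun t ht =>
      hasDerivAt_fst (hasDerivAt_snd (hγ t ht))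
    have hE : ∀ t ∈ I, HasDerivAt (fun τ => (γ τ).2.2.1) (D.partField k (γ t)).2.2.1 t :=
      fun t ht => hasDerivAt_fst (hasDerivAt_snd (hasDerivAt_snd (hγ t ht)))
    have hB : ∀ t ∈ I, HasDerivAt (fun τ => (γ τ).2.2.2) (D.partField k (γ t)).2.2.2 t :=
      fun t ht => hasDerivAt_snd (hasDerivAt_snd (hasDerivAt_snd (hγ t ht)))
    apply key
    cases k with
    | E =>
      have h1 := eqOn_of_hasDerivAt hI hc h0 hfst (fun t _ => hasDerivAt_const t z.1) (by rw [hz])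
      have h2 := eqOn_of_hasDerivAt hI hc h0 hE (fun t _ => hasDerivAt_const t z.2.2.1) (by rw [hz])
      intro t ht
      simp only [partField, flow, h1 t ht, h2 t ht]
    | B =>
      have h2 := eqOn_of_hasDerivAt hI hc h0 hB (fun t _ => hasDerivAt_const t z.2.2.2) (by rw [hz])
      intro t ht
      simp only [partField, flow, h2 t ht]
    | v i =>
      have h2 := eqOn_of_hasDerivAt hI hc h0 hB (fun t _ => hasDerivAt_const t z.2.2.2) (by rw [hz])
      have hVi : ∀ s, ∀ t ∈ I, (γ t).2.1 s i = z.2.1 s i := by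
        intro s
        refine eqOn_of_hasDerivAt hI hc h0 (f' := fun _ => 0) (fun t ht => ?_)
          (fun t _ => hasDerivAt_const t _) (by rw [hz])
        refine (hasDerivAt_pi.1 (hasDerivAt_pi.1 (hV t ht) s) i).congr_deriv ?_
        simp only [partField]
        fin_cases i <;> simp [cross_apply]
      have h1 := eqOn_of_hasDerivAt hI hc h0 (f := fun τ => (γ τ).1)
        (g := fun τ => (D.flow (.v i) τ z).1)
        (f' := fun _ s => z.2.1 s i • Pi.single i 1) (fun t ht => (hfst t ht).congr_deriv (by
          simp only [partField, hVi _ t ht]))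
        (fun t ht => by
          refine (hasDerivAt_fst (hD.hasDerivAt_flow (.v i) z t)).congr_deriv ?_
          funext s
          simp only [partField, flow_v_velocity])
        (by rw [hz, flow_zero])
      intro t ht
      simp only [partField, flow_v_velocity, h1 t ht, h2 t ht, hVi _ t ht]
      rfl
  · intro h
    have hev : ∀ t ∈ I, γ =ᶠ[𝓝 t] fun τ => D.flow k τ z := fun t ht =>
      (hI.eventually_mem ht).mono h
    refine ⟨by rw [h 0 h0, flow_zero], fun t ht => ?_⟩
    rw [h t ht]
    exact (hD.hasDerivAt_flow k z t).congr_of_eventuallyEq (hev t ht)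

omit hD in
-- In a velocity substep `V_s[i]` is conserved, so the return step runs over the same segment in the
-- opposite direction and its line integrals change sign.
theorem flow_flow_neg (k : Part) (t : ℝ) (z : Phase N Ne Nb) :
    D.flow k t (D.flow k (-t) z) = z := by
  cases k with
  | E => simp [flow]
  | B => simp [flow]
  | v i =>
    have hv := fun s => flow_v_velocity (D := D) i (-t) z s
    have hX : ∀ s, (D.flow (.v i) (-t) z).1 s = z.1 s + (-t * z.2.1 s i) • Pi.single i 1 :=
      fun s => rfl
    have hL : ∀ {n : ℕ} (M : (Fin 3 → ℝ) → Matrix (Fin n) (Fin 3) ℝ) s,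
        lineIntegral M i (z.1 s + (-t * z.2.1 s i) • Pi.single i 1) (t * z.2.1 s i)
          = -lineIntegral M i (z.1 s) (-t * z.2.1 s i) := by
      intro n M s
      ext j k
      rw [neg_apply, lineIntegral_apply, lineIntegral_apply, ← seg_neg]
      congr 1; ring
    refine Prod.ext ?_ (Prod.ext ?_ (Prod.ext ?_ rfl))
    · funext s
      change (D.flow (.v i) (-t) z).1 s + (t * (D.flow (.v i) (-t) z).2.1 s i) • Pi.single i 1
        = z.1 s
      rw [hv, hX, add_assoc, ← add_smul]
      simp
    · funext s
      change (D.flow (.v i) (-t) z).2.1 s + crossProduct (Pi.single i 1)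
          ((lineIntegral D.sampleB i ((D.flow (.v i) (-t) z).1 s)
            (t * (D.flow (.v i) (-t) z).2.1 s i))ᵀ *ᵥ z.2.2.2) = z.2.1 s
      rw [hv, hX, hL, transpose_neg, neg_mulVec, map_neg]
      exact add_neg_cancel_right _ _
    · change (D.flow (.v i) (-t) z).2.2.1 - D.massE⁻¹ *ᵥ ∑ s, D.weight s •
          lineIntegral D.sampleE i ((D.flow (.v i) (-t) z).1 s)
            (t * (D.flow (.v i) (-t) z).2.1 s i) *ᵥ Pi.single i 1 = z.2.2.1
      simp only [hv, hX, hL, neg_mulVec, smul_neg, Finset.sum_neg_distrib, mulVec_neg,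
        sub_neg_eq_add]
      exact sub_add_cancel _ _

theorem isWeakDiv_flow_iff (k : Part) (t : ℝ) (z : Phase N Ne Nb) (g : L2Scal D.Ω) :
    IsWeakDiv D.Ω (D.magneticField (D.flow k t z)) g ↔ IsWeakDiv D.Ω (D.magneticField z) g := by
  refine ⟨fun h => ?_, hD.isWeakDiv_flow_of k t z g⟩
  have := hD.isWeakDiv_flow_of k (-t) _ g h
  have h2 := flow_flow_neg (D := D) k (-t) z
  rw [neg_neg] at h2
  rwa [h2] at this

theorem isWeakDiv_compose (l : List (Part × ℝ)) {z : Phase N Ne Nb}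
    (h : IsWeakDiv D.Ω (D.magneticField z) 0) :
    IsWeakDiv D.Ω (D.magneticField (D.compose l z)) 0 := by
  induction l with
  | nil => exact h
  | cons a l ih => exact hD.isWeakDiv_flow_of a.1 a.2 _ 0 ih

theorem isWeakDiv_iterate_compose (l : List (Part × ℝ)) {z : Phase N Ne Nb}
    (h : IsWeakDiv D.Ω (D.magneticField z) 0) (n : ℕ) :
    IsWeakDiv D.Ω (D.magneticField ((D.compose l)^[n] z)) 0 := by
  induction n with
  | zero => exact h
  | succ n ih =>
    rw [Function.iterate_succ_apply']
    exact hD.isWeakDiv_compose l ih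

omit hD in
-- The composition is a palindrome, so the factors cancel in pairs from the inside out.
theorem secondOrderScheme_symm (h : ℝ) (z : Phase N Ne Nb) :
    D.secondOrderScheme h (D.secondOrderScheme (-h) z) = z := by
  simp only [secondOrderScheme, compose, neg_div, flow_flow_neg]

end Admissible

end Discretisation

/-! ### Ingredients for the invariance of the bracket. -/

theorem hasDerivAt_seg_joint {m : (Fin 3 → ℝ) → ℝ} (hm : ContDiff ℝ ∞ m) (i : Fin 3)
    (X ξ : Fin 3 → ℝ) (d δ : ℝ) :
    HasDerivAt (fun τ : ℝ => seg m i (X + τ • ξ) (d + τ * δ))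
      (seg (fun Y => fderiv ℝ m Y ξ) i X d + δ * m (X + d • Pi.single i 1)) 0 := by
  -- Joint differentiability lets the derivative be assembled from its two partials: differentiation
  -- under the integral in `X`, and the endpoint value in `d`.
  have hd := (contDiff_seg i hm).differentiable (by simp) (X, d)
  have h1 : fderiv ℝ (fun q : (Fin 3 → ℝ) × ℝ => seg m i q.1 q.2) (X, d) (ξ, 0)
      = seg (fun Y => fderiv ℝ m Y ξ) i X d := by
    refine fderiv_eq_of_line hd ?_
    simpa using hasDerivAt_seg_line i X d hm ξ
  have h2 : fderiv ℝ (fun q : (Fin 3 → ℝ) × ℝ => seg m i q.1 q.2) (X, d) (0, δ)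
      = δ * m (X + d • Pi.single i 1) := by
    refine fderiv_eq_of_line hd ?_
    have hl : HasDerivAt (fun τ : ℝ => d + τ * δ) δ 0 := by
      simpa using ((hasDerivAt_id' (0 : ℝ)).mul_const δ).const_add d
    have h0 : HasDerivAt (seg m i X) (m (X + d • Pi.single i 1)) (d + 0 * δ) := by
      simpa using hasDerivAt_seg i X d hm
    simpa [Function.comp_def, mul_comm] using h0.comp (0 : ℝ) hl
  have hl : HasDerivAt (fun τ : ℝ => (X + τ • ξ, d + τ * δ)) (ξ, δ) 0 := by
    refine HasDerivAt.prodMk ?_ ?_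
    · simpa using ((hasDerivAt_id' (0 : ℝ)).smul_const ξ).const_add X
    · simpa using ((hasDerivAt_id' (0 : ℝ)).mul_const δ).const_add d
  have h0 : HasFDerivAt (fun q : (Fin 3 → ℝ) × ℝ => seg m i q.1 q.2)
      (fderiv ℝ (fun q : (Fin 3 → ℝ) × ℝ => seg m i q.1 q.2) (X, d))
      (X + (0 : ℝ) • ξ, d + (0 : ℝ) * δ) := by
    simpa using hd.hasFDerivAt
  have h := h0.comp_hasDerivAt (0 : ℝ) hl
  have hsplit : ((ξ, δ) : (Fin 3 → ℝ) × ℝ) = (ξ, 0) + (0, δ) := by simp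
  rw [hsplit, map_add, h1, h2] at h
  exact h

theorem seg_add (i : Fin 3) (X : Fin 3 → ℝ) (d : ℝ) {f g : (Fin 3 → ℝ) → ℝ} (hf : Continuous f)
    (hg : Continuous g) : seg (fun Y => f Y + g Y) i X d = seg f i X d + seg g i X d := by
  simp only [seg]
  exact intervalIntegral.integral_add ((hf.comp (by fun_prop)).intervalIntegrable _ _)
    ((hg.comp (by fun_prop)).intervalIntegrable _ _)

theorem seg_crossProduct (i : Fin 3) (X : Fin 3 → ℝ) (d : ℝ) (w : (Fin 3 → ℝ) → Fin 3 → ℝ)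
    (k : Fin 3) : seg (fun Y => crossProduct (Pi.single i 1) (w Y) k) i X d
      = crossProduct (Pi.single i 1) (fun c => seg (fun Y => w Y c) i X d) k := by
  fin_cases i <;> fin_cases k <;> simp [cross_apply, seg]

/-- The Poisson property of the update map of one velocity component, for a single particle. -/
theorem single_particle_identity (i : Fin 3) {w : ℝ} (hw : w ≠ 0) (t : ℝ)
    (x₁ x₂ v₁ v₂ a₁ a₂ a₁' a₂' c₁ c₂ β β' y₁ y₂ u₁ u₂ : Fin 3 → ℝ) (T : Fin 3 → Fin 3 → ℝ)
    (hT : ∀ c, T i c = β' c - β c) (htr : ∑ k, T k k = 0)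
    (hy₁ : ∀ k, y₁ k = x₁ k + v₁ ⬝ᵥ crossProduct (Pi.single i 1) (T k)
      - w * (a₁' k - a₁ k + crossProduct (Pi.single i 1) c₁ k))
    (hy₂ : ∀ k, y₂ k = x₂ k + v₂ ⬝ᵥ crossProduct (Pi.single i 1) (T k)
      - w * (a₂' k - a₂ k + crossProduct (Pi.single i 1) c₂ k))
    (hu₁ : u₁ = v₁ + (t * (x₁ i + v₁ ⬝ᵥ crossProduct (Pi.single i 1) β' - w * a₁' i)) •
      (Pi.single i 1 : Fin 3 → ℝ))
    (hu₂ : u₂ = v₂ + (t * (x₂ i + v₂ ⬝ᵥ crossProduct (Pi.single i 1) β' - w * a₂' i)) •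
      (Pi.single i 1 : Fin 3 → ℝ)) :
    1 / w * (y₁ ⬝ᵥ u₂ - y₂ ⬝ᵥ u₁) + (a₂ ⬝ᵥ u₁ - a₁ ⬝ᵥ u₂)
        + 1 / w * (β ⬝ᵥ crossProduct u₁ u₂)
        + (v₂ ⬝ᵥ crossProduct (Pi.single i 1) c₁ - v₁ ⬝ᵥ crossProduct (Pi.single i 1) c₂)
      = 1 / w * (x₁ ⬝ᵥ v₂ - x₂ ⬝ᵥ v₁) + (a₂' ⬝ᵥ v₁ - a₁' ⬝ᵥ v₂)
        + 1 / w * (β' ⬝ᵥ crossProduct v₁ v₂) := by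
  -- Indices 1 and 2 belong to `F` and `G`. Here `x`, `v` are the position and velocity gradients at
  -- the image point and `y`, `u` those of the composed functions; `a`, `a'` are the electric
  -- samples of `massE⁻¹ ∂/∂E_D`, and `β`, `β'` the magnetic samples, at the old and new positions;
  -- `c` is the path integral of the sampled curl, and `T k` that of the `k`-th derivative of the
  -- sampled magnetic field.
  subst hu₁ hu₂
  have hT0 := hT 0
  have hT1 := hT 1
  have hT2 := hT 2
  rw [Fin.sum_univ_three] at htr
  fin_cases i
  · simp only [Fin.zero_eta, Fin.isValue] at *
    -- The entry `T i i` is fixed by the endpoint values, so zero trace eliminates one of the two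
    -- transverse diagonal entries; the rest is a rational identity in the components.
    have h22 : T 2 2 = - T 1 1 - (β' 0 - β 0) := by linarith
    simp [dotProduct, Fin.sum_univ_three, cross_apply, hy₁, hy₂, hT1, hT2, h22]
    field_simp
    ring
  · simp only [Fin.mk_one, Fin.isValue] at *
    have h22 : T 2 2 = - T 0 0 - (β' 1 - β 1) := by linarith
    simp [dotProduct, Fin.sum_univ_three, cross_apply, hy₁, hy₂, hT0, hT2, h22]
    field_simp
    ring
  · simp only [Fin.reduceFinMk, Fin.isValue] at *
    have h22 : T 1 1 = - T 0 0 - (β' 2 - β 2) := by linarith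
    simp [dotProduct, Fin.sum_univ_three, cross_apply, hy₁, hy₂, hT0, hT1, h22]
    field_simp
    ring

namespace Discretisation

variable {N Ne Nb : ℕ} {D : Discretisation N Ne Nb}

/-- The bracket as a sum over the particles and a pure field part. -/
theorem bracket_eq (F G : Phase N Ne Nb → ℝ) (z : Phase N Ne Nb) :
    D.bracket F G z = ∑ s, (1 / D.weight s * (gradX F z s ⬝ᵥ gradV G z s - gradX G z s ⬝ᵥ gradV F z s)
        + (((D.sampleE (z.1 s))ᵀ *ᵥ D.massE⁻¹ *ᵥ gradE G z) ⬝ᵥ gradV F z s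
          - ((D.sampleE (z.1 s))ᵀ *ᵥ D.massE⁻¹ *ᵥ gradE F z) ⬝ᵥ gradV G z s)
        + 1 / D.weight s * (((D.sampleB (z.1 s))ᵀ *ᵥ z.2.2.2) ⬝ᵥ
            crossProduct (gradV F z s) (gradV G z s)))
      + ((D.massB⁻¹ *ᵥ D.curlMatrixᵀ *ᵥ D.massE⁻¹ *ᵥ gradE F z) ⬝ᵥ gradB G z
        - (D.massB⁻¹ *ᵥ D.curlMatrixᵀ *ᵥ D.massE⁻¹ *ᵥ gradE G z) ⬝ᵥ gradB F z) := by
  have hE : ∀ {n : ℕ} (A : Matrix (Fin Ne) (Fin n) ℝ) (e : Fin Ne → ℝ) (v : Fin n → ℝ),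
      e ⬝ᵥ (D.massE⁻¹ * A) *ᵥ v = (Aᵀ *ᵥ D.massE⁻¹ *ᵥ e) ⬝ᵥ v := by
    intro n A e v
    rw [dotProduct_mulVec, ← vecMul_vecMul, ← mulVec_transpose D.massE⁻¹, massE_inv_transpose,
      mulVec_transpose]
  have hB : ∀ s (c : Fin 3 → ℝ), z.2.2.2 ⬝ᵥ D.sampleB (z.1 s) *ᵥ c
      = ((D.sampleB (z.1 s))ᵀ *ᵥ z.2.2.2) ⬝ᵥ c := by
    intro s c
    rw [dotProduct_mulVec, mulVec_transpose]
  simp only [bracket, Matrix.mul_assoc, hE, hB, transpose_mul, massB_inv_transpose]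
  simp only [← mulVec_mulVec, Finset.sum_add_distrib]
  ring

/-- The chain rule for the partial gradients, from the derivative of the update map along lines. -/
theorem fderiv_comp_of_line {F : Phase N Ne Nb → ℝ} {Φ : Phase N Ne Nb → Phase N Ne Nb}
    (hF : ContDiff ℝ ∞ F) (hΦ : ContDiff ℝ ∞ Φ) {z u d : Phase N Ne Nb}
    (h : HasDerivAt (fun τ : ℝ => Φ (z + τ • u)) d 0) :
    fderiv ℝ (fun y => F (Φ y)) z u
      = ∑ s, gradX F (Φ z) s ⬝ᵥ d.1 s + ∑ s, gradV F (Φ z) s ⬝ᵥ d.2.1 s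
      + gradE F (Φ z) ⬝ᵥ d.2.2.1 + gradB F (Φ z) ⬝ᵥ d.2.2.2 := by
  have h1 := fderiv_eq_of_line (hΦ.differentiable (by simp) z) h
  have h2 := ((hF.differentiable (by simp) (Φ z)).hasFDerivAt.comp z
    (hΦ.differentiable (by simp) z).hasFDerivAt).fderiv
  rw [← fderiv_apply_eq, ← h1]
  exact congrArg (· u) h2

end Discretisation

/-! ### Invariance of the bracket under the two field substeps. -/

namespace Discretisation

variable {N Ne Nb : ℕ} {D : Discretisation N Ne Nb}

theorem massE_inv_dotProduct_comm (a b : Fin Ne → ℝ) :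
    (D.massE⁻¹ *ᵥ a) ⬝ᵥ b = (D.massE⁻¹ *ᵥ b) ⬝ᵥ a := by
  rw [dotProduct_comm, dotProduct_mulVec, ← mulVec_transpose, massE_inv_transpose]

theorem massB_inv_dotProduct_comm (a b : Fin Nb → ℝ) :
    (D.massB⁻¹ *ᵥ a) ⬝ᵥ b = (D.massB⁻¹ *ᵥ b) ⬝ᵥ a := by
  rw [dotProduct_comm, dotProduct_mulVec, ← mulVec_transpose, massB_inv_transpose]

theorem transpose_mulVec_dotProduct {m n : ℕ} (A : Matrix (Fin m) (Fin n) ℝ) (a : Fin m → ℝ)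
    (b : Fin n → ℝ) : (Aᵀ *ᵥ a) ⬝ᵥ b = a ⬝ᵥ A *ᵥ b := by
  rw [dotProduct_mulVec, mulVec_transpose]

theorem eq_of_dotProduct_single {n : ℕ} {f g : Fin n → ℝ}
    (h : ∀ j, f j = g ⬝ᵥ Pi.single j 1) : f = g := by
  funext j; simpa using h j

namespace Admissible

variable (hD : D.Admissible)

include hD

/-- The map is linear, and only the `B_D`-gradient changes, by `t curlMatrixᵀ massE⁻¹ ∂F/∂E_D`. Its
contribution is a symmetric bilinear expression in `F` and `G`, because `massB⁻¹` is symmetric, so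
it drops out of the bracket. -/
theorem bracket_flow_B (t : ℝ) {F G : Phase N Ne Nb → ℝ} (hF : ContDiff ℝ ∞ F)
    (hG : ContDiff ℝ ∞ G) (z : Phase N Ne Nb) :
    D.bracket (fun y => F (D.flow .B t y)) (fun y => G (D.flow .B t y)) z
      = D.bracket F G (D.flow .B t z) := by
  have hline : ∀ u : Phase N Ne Nb, HasDerivAt (fun τ : ℝ => D.flow .B t (z + τ • u))
      (D.flow .B t u) 0 := by
    intro u
    have h : (fun τ : ℝ => D.flow .B t (z + τ • u))
        = fun τ => D.flow .B t z + τ • D.flow .B t u := by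
      funext τ
      refine Prod.ext rfl (Prod.ext rfl (Prod.ext ?_ rfl))
      simp only [flow, Prod.snd_add, Prod.fst_add, Prod.smul_snd, Prod.smul_fst, mulVec_add,
        mulVec_smul, smul_add]
      rw [smul_comm t τ]
      abel
    rw [h]
    simpa using ((hasDerivAt_id' (0 : ℝ)).smul_const (D.flow .B t u)).const_add (D.flow .B t z)
  have hg : ∀ F : Phase N Ne Nb → ℝ, ContDiff ℝ ∞ F →
      gradX (fun y => F (D.flow .B t y)) z = gradX F (D.flow .B t z) ∧
      gradV (fun y => F (D.flow .B t y)) z = gradV F (D.flow .B t z) ∧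
      gradE (fun y => F (D.flow .B t y)) z = gradE F (D.flow .B t z) ∧
      gradB (fun y => F (D.flow .B t y)) z = gradB F (D.flow .B t z)
        + t • D.curlMatrixᵀ *ᵥ D.massE⁻¹ *ᵥ gradE F (D.flow .B t z) := by
    intro F hF
    have h := fun u => fderiv_comp_of_line hF (hD.contDiff_flow .B t) (hline u)
    simp only [← fderiv_apply_eq] at h
    refine ⟨?_, ?_, ?_, ?_⟩
    · funext s k; simp only [gradX, h]; simp [flow]
    · funext s k; simp only [gradV, h]; simp [flow]
    · funext j; simp only [gradE, h]; simp [flow]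
    · refine eq_of_dotProduct_single fun j => ?_
      simp only [gradB, h]
      rw [fderiv_apply_eq, add_dotProduct, smul_dotProduct, transpose_mulVec_dotProduct,
        massE_inv_dotProduct_comm]
      simp [flow, dotProduct_comm (gradE F _), -mulVec_mulVec]
      ring
  obtain ⟨f1, f2, f3, f4⟩ := hg F hF
  obtain ⟨g1, g2, g3, g4⟩ := hg G hG
  rw [bracket_eq, bracket_eq, f1, f2, f3, f4, g1, g2, g3, g4]
  refine congrArg₂ (· + ·) rfl ?_
  simp only [dotProduct_add, dotProduct_smul]
  rw [massB_inv_dotProduct_comm _ (D.curlMatrixᵀ *ᵥ D.massE⁻¹ *ᵥ gradE G (D.flow .B t z))]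
  ring

/-- The kick adds its Jacobian to the position gradients; antisymmetrised, this yields the sampled
curl against `∂F/∂V × ∂G/∂V`, which is exactly the effect of the update of `B_D` on the magnetic
term. The divergence constraint plays no role here. -/
theorem bracket_flow_E (t : ℝ) {F G : Phase N Ne Nb → ℝ} (hF : ContDiff ℝ ∞ F)
    (hG : ContDiff ℝ ∞ G) (z : Phase N Ne Nb) :
    D.bracket (fun y => F (D.flow .E t y)) (fun y => G (D.flow .E t y)) z
      = D.bracket F G (D.flow .E t z) := by
  -- `J s b k` is the derivative of component `b` of the sampled electric field in direction `k`
  set J : Fin N → Fin 3 → Fin 3 → ℝ := fun s b k =>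
    fderiv ℝ (fun Y => ((D.sampleE Y)ᵀ *ᵥ z.2.2.1) b) (z.1 s) (Pi.single k 1) with hJ
  have hline : ∀ u : Phase N Ne Nb, HasDerivAt (fun τ : ℝ => D.flow .E t (z + τ • u))
      (u.1, fun s => u.2.1 s + t • ((D.sampleE (z.1 s))ᵀ *ᵥ u.2.2.1
        + fun b => fderiv ℝ (fun Y => ((D.sampleE Y)ᵀ *ᵥ z.2.2.1) b) (z.1 s) (u.1 s)),
        u.2.2.1, u.2.2.2 - t • D.massB⁻¹ *ᵥ D.curlMatrixᵀ *ᵥ u.2.2.1) 0 := by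
    intro u
    have hid : ∀ {E : Type} [NormedAddCommGroup E] [NormedSpace ℝ E] (a b : E),
        HasDerivAt (fun τ : ℝ => a + τ • b) b 0 := by
      intro E _ _ a b
      simpa using ((hasDerivAt_id' (0 : ℝ)).smul_const b).const_add a
    refine (hid z.1 u.1).prodMk (HasDerivAt.prodMk (hasDerivAt_pi.2 fun s => ?_)
      ((hid z.2.2.1 u.2.2.1).prodMk ?_))
    · refine (hid (z.2.1 s) (u.2.1 s)).fun_add (HasDerivAt.fun_const_smul t
        (hasDerivAt_pi.2 fun b => ?_))
      have h1 : HasDerivAt (fun τ : ℝ => ((D.sampleE (z.1 s + τ • u.1 s))ᵀ *ᵥ z.2.2.1) b)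
          (fderiv ℝ (fun Y => ((D.sampleE Y)ᵀ *ᵥ z.2.2.1) b) (z.1 s) (u.1 s)) 0 := by
        have h0 : HasFDerivAt (fun Y => ((D.sampleE Y)ᵀ *ᵥ z.2.2.1) b)
            (fderiv ℝ (fun Y => ((D.sampleE Y)ᵀ *ᵥ z.2.2.1) b) (z.1 s))
            (z.1 s + (0 : ℝ) • u.1 s) := by
          simpa using ((hD.contDiff_sampleE_mulVec z.2.2.1 b).differentiable
            (by simp) (z.1 s)).hasFDerivAt
        exact h0.comp_hasDerivAt (0 : ℝ) (hid (z.1 s) (u.1 s))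
      -- By the product rule at `τ = 0` the derivative of the sampling matrix is multiplied by zero.
      have h2 : HasDerivAt (fun τ : ℝ => τ * ((D.sampleE (z.1 s + τ • u.1 s))ᵀ *ᵥ u.2.2.1) b)
          (((D.sampleE (z.1 s))ᵀ *ᵥ u.2.2.1) b) 0 := by
        have hd : DifferentiableAt ℝ
            (fun τ : ℝ => ((D.sampleE (z.1 s + τ • u.1 s))ᵀ *ᵥ u.2.2.1) b) 0 :=
          ((hD.contDiff_sampleE_mulVec u.2.2.1 b).comp
            (f := fun τ : ℝ => z.1 s + τ • u.1 s) (by fun_prop)).differentiable (by simp) 0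
        refine ((hasDerivAt_id' (0 : ℝ)).fun_mul hd.hasDerivAt).congr_deriv ?_
        simp
      refine (h2.fun_add h1).congr_of_eventuallyEq (Eventually.of_forall fun τ => ?_)
      simp [mulVec_add, mulVec_smul]
      ring
    · have h := (hid z.2.2.2 u.2.2.2).fun_sub (HasDerivAt.fun_const_smul t
        (HasDerivAt.linearMap_comp (D.massB⁻¹.mulVecLin ∘ₗ D.curlMatrixᵀ.mulVecLin)
          (hid z.2.2.1 u.2.2.1)))
      exact h
  have hg : ∀ F : Phase N Ne Nb → ℝ, ContDiff ℝ ∞ F →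
      (∀ s k, gradX (fun y => F (D.flow .E t y)) z s k = gradX F (D.flow .E t z) s k
        + t * ∑ b, gradV F (D.flow .E t z) s b * J s b k) ∧
      gradV (fun y => F (D.flow .E t y)) z = gradV F (D.flow .E t z) ∧
      gradE (fun y => F (D.flow .E t y)) z = gradE F (D.flow .E t z)
        + t • (∑ s, D.sampleE (z.1 s) *ᵥ gradV F (D.flow .E t z) s
          - D.curlMatrix *ᵥ D.massB⁻¹ *ᵥ gradB F (D.flow .E t z)) ∧
      gradB (fun y => F (D.flow .E t y)) z = gradB F (D.flow .E t z) := by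
    intro F hF
    have h := fun u => fderiv_comp_of_line hF (hD.contDiff_flow .E t) (hline u)
    refine ⟨?_, ?_, ?_, ?_⟩
    · intro s k
      rw [gradX, h]
      simp only [mulVec_zero, zero_add, dotProduct_zero, smul_zero, sub_zero, add_zero,
        Pi.zero_apply]
      rw [Finset.sum_eq_single s (by intro r _ hr; simp [hr]) (by simp),
        Finset.sum_eq_single s (by
          intro r _ hr
          simp only [Pi.single_eq_of_ne hr, map_zero]
          simp [dotProduct]) (by simp)]
      simp only [Pi.single_eq_same, dotProduct_single, mul_one, dotProduct_smul, smul_eq_mul]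
      rfl
    · funext s k
      rw [gradV, h]
      simp only [mulVec_zero, zero_add, dotProduct_zero, smul_zero, sub_zero, add_zero,
        Pi.zero_apply, map_zero, Finset.sum_const_zero]
      have h0 : ((fun _ => 0) : Fin 3 → ℝ) = 0 := rfl
      simp only [h0, smul_zero, add_zero]
      rw [Finset.sum_eq_single s (by intro r _ hr; simp [hr]) (by simp)]
      simp
    · refine eq_of_dotProduct_single fun j => ?_
      rw [gradE, h, add_dotProduct, smul_dotProduct, sub_dotProduct, sum_dotProduct]
      have h0 : ((fun _ => 0) : Fin 3 → ℝ) = 0 := rfl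
      simp only [zero_add, dotProduct_zero, add_zero, zero_sub,
        Pi.zero_apply, map_zero, Finset.sum_const_zero, h0, dotProduct_smul, dotProduct_neg]
      have hs : ∀ s, gradV F (D.flow .E t z) s ⬝ᵥ (D.sampleE (z.1 s))ᵀ *ᵥ Pi.single j 1
          = D.sampleE (z.1 s) *ᵥ gradV F (D.flow .E t z) s ⬝ᵥ Pi.single j 1 := by
        intro s
        rw [dotProduct_comm, transpose_mulVec_dotProduct, dotProduct_comm]
      have hb : gradB F (D.flow .E t z) ⬝ᵥ D.massB⁻¹ *ᵥ D.curlMatrixᵀ *ᵥ Pi.single j 1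
          = D.curlMatrix *ᵥ D.massB⁻¹ *ᵥ gradB F (D.flow .E t z) ⬝ᵥ Pi.single j 1 := by
        rw [dotProduct_comm, massB_inv_dotProduct_comm, dotProduct_comm,
          transpose_mulVec_dotProduct, dotProduct_comm]
      simp only [hs, hb, smul_eq_mul, ← Finset.mul_sum]
      ring
    · funext j
      rw [gradB, h]
      have h0 : ((fun _ => 0) : Fin 3 → ℝ) = 0 := rfl
      simp [h0, gradB]
  obtain ⟨f1, f2, f3, f4⟩ := hg F hF
  obtain ⟨g1, g2, g3, g4⟩ := hg G hG
  rw [bracket_eq, bracket_eq, f2, f3, f4, g2, g3, g4]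
  set v₁ := gradV F (D.flow .E t z)
  set v₂ := gradV G (D.flow .E t z)
  set x₁ := gradX F (D.flow .E t z)
  set x₂ := gradX G (D.flow .E t z)
  set e₁ := gradE F (D.flow .E t z)
  set e₂ := gradE G (D.flow .E t z)
  set b₁ := gradB F (D.flow .E t z)
  set b₂ := gradB G (D.flow .E t z)
  set s₁ := ∑ s, D.sampleE (z.1 s) *ᵥ v₁ s with hs₁
  set s₂ := ∑ s, D.sampleE (z.1 s) *ᵥ v₂ s with hs₂
  set k₁ := D.curlMatrix *ᵥ D.massB⁻¹ *ᵥ b₁ with hk₁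
  set k₂ := D.curlMatrix *ᵥ D.massB⁻¹ *ᵥ b₂ with hk₂
  -- The antisymmetric part of the Jacobian `J s` acts as a cross product with the curl.
  have hXs : ∀ s, gradX (fun y => F (D.flow .E t y)) z s ⬝ᵥ v₂ s
      - gradX (fun y => G (D.flow .E t y)) z s ⬝ᵥ v₁ s
      = x₁ s ⬝ᵥ v₂ s - x₂ s ⬝ᵥ v₁ s - t * (((D.sampleB (z.1 s))ᵀ *ᵥ D.massB⁻¹ *ᵥ
          D.curlMatrixᵀ *ᵥ z.2.2.1) ⬝ᵥ crossProduct (v₁ s) (v₂ s)) := by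
    intro s
    obtain ⟨c0, c1, c2⟩ := hD.curl_sampleE z.2.2.1 (z.1 s)
    simp only [dotProduct, Fin.sum_univ_three, f1, g1, ← c0, ← c1, ← c2, hJ, cross_apply,
      Matrix.cons_val]
    ring
  have hz : ∀ s, (D.flow .E t z).1 s = z.1 s := fun _ => rfl
  have hB : (D.flow .E t z).2.2.2
      = z.2.2.2 - t • D.massB⁻¹ *ᵥ D.curlMatrixᵀ *ᵥ z.2.2.1 := rfl
  have hsum : ∀ (p : Fin Ne → ℝ) (v : Fin N → Fin 3 → ℝ),
      ∑ s, ((D.sampleE (z.1 s))ᵀ *ᵥ p) ⬝ᵥ v s = p ⬝ᵥ ∑ s, D.sampleE (z.1 s) *ᵥ v s := by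
    intro p v
    simp only [transpose_mulVec_dotProduct, dotProduct_sum]
  have hK : ∀ (p : Fin Ne → ℝ) (b : Fin Nb → ℝ), (D.massB⁻¹ *ᵥ D.curlMatrixᵀ *ᵥ p) ⬝ᵥ b
      = p ⬝ᵥ D.curlMatrix *ᵥ D.massB⁻¹ *ᵥ b := by
    intro p b
    rw [massB_inv_dotProduct_comm, dotProduct_comm, transpose_mulVec_dotProduct]
  simp only [hXs, hz, hB, Finset.sum_add_distrib, Finset.sum_sub_distrib, hsum, hK, ← hs₁, ← hs₂,
    ← hk₁, ← hk₂, mulVec_sub, sub_dotProduct, mulVec_add, mulVec_smul, add_dotProduct,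
    smul_dotProduct, smul_eq_mul, mul_sub]
  simp only [← Finset.mul_sum, hsum, ← hs₁, ← hs₂]
  -- The surviving terms in `t` antisymmetrise the form `massE⁻¹` on `s₁ - k₁` and `s₂ - k₂`, and
  -- vanish by its symmetry.
  have m1 := massE_inv_dotProduct_comm (D := D) s₁ s₂
  have m2 := massE_inv_dotProduct_comm (D := D) s₁ k₂
  have m3 := massE_inv_dotProduct_comm (D := D) k₁ s₂
  have m4 := massE_inv_dotProduct_comm (D := D) k₁ k₂
  linear_combination (-t) * m1 + t * m2 + t * m3 - t * m4

end Admissible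

end Discretisation

/-! ### Invariance of the bracket under the velocity substeps, and under compositions. -/

namespace Discretisation

variable {N Ne Nb : ℕ} {D : Discretisation N Ne Nb}

namespace Admissible

variable (hD : D.Admissible)

include hD

theorem fderiv_sampleB_mulVec (q : Fin Nb → ℝ) (X ξ : Fin 3 → ℝ) (b : Fin 3) :
    fderiv ℝ (fun Y => ((D.sampleB Y)ᵀ *ᵥ q) b) X ξ
      = ∑ j, fderiv ℝ (fun Y => D.sampleB Y j b) X ξ * q j := by
  have hd : ∀ j, DifferentiableAt ℝ (fun Y => D.sampleB Y j b) X := fun j =>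
    (hD.contDiff_sampleB j b).differentiable (by simp) X
  simp only [sampleB_transpose_mulVec]
  rw [fderiv_fun_sum fun j _ => (hd j).mul_const _]
  rw [_root_.sum_apply]
  refine Finset.sum_congr rfl fun j _ => ?_
  rw [fderiv_mul_const (hd j), _root_.smul_apply, smul_eq_mul, mul_comm]

omit hD in
theorem continuous_fderiv_apply {m : (Fin 3 → ℝ) → ℝ} (hm : ContDiff ℝ ∞ m) (ξ : Fin 3 → ℝ) :
    Continuous fun Y => fderiv ℝ m Y ξ :=
  (hm.continuous_fderiv (by simp)).clm_apply continuous_const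

/-- The curl relation between the sampled fields, solved for a partial derivative. -/
theorem fderiv_sampleE_comm (p : Fin Ne → ℝ) (i k : Fin 3) (X : Fin 3 → ℝ) :
    fderiv ℝ (fun Y => ((D.sampleE Y)ᵀ *ᵥ p) i) X (Pi.single k 1)
      = fderiv ℝ (fun Y => ((D.sampleE Y)ᵀ *ᵥ p) k) X (Pi.single i 1)
        + crossProduct (Pi.single i 1)
          ((D.sampleB X)ᵀ *ᵥ D.massB⁻¹ *ᵥ D.curlMatrixᵀ *ᵥ p) k := by
  obtain ⟨c0, c1, c2⟩ := hD.curl_sampleE p X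
  fin_cases i <;> fin_cases k <;> simp [cross_apply, -mulVec_mulVec, ← c0, ← c1, ← c2]

/-- The curl relation exchanges `∂_k E_i` for `∂_i E_k` plus a curl component. Along direction `i`
the first integrates to an endpoint difference, the second to the line integral of the sampled
magnetic basis. -/
theorem seg_fderiv_sampleE (p : Fin Ne → ℝ) (i k : Fin 3) (X : Fin 3 → ℝ) (d : ℝ) :
    seg (fun Y => fderiv ℝ (fun Y => ((D.sampleE Y)ᵀ *ᵥ p) i) Y (Pi.single k 1)) i X d
      = ((D.sampleE (X + d • Pi.single i 1))ᵀ *ᵥ p) k - ((D.sampleE X)ᵀ *ᵥ p) k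
        + crossProduct (Pi.single i 1) ((lineIntegral D.sampleB i X d)ᵀ *ᵥ
            D.massB⁻¹ *ᵥ D.curlMatrixᵀ *ᵥ p) k := by
  have hL : (lineIntegral D.sampleB i X d)ᵀ *ᵥ D.massB⁻¹ *ᵥ D.curlMatrixᵀ *ᵥ p
      = fun c => seg (fun Y => ((D.sampleB Y)ᵀ *ᵥ D.massB⁻¹ *ᵥ D.curlMatrixᵀ *ᵥ p) c) i X d :=
    funext fun c => hD.lineIntegral_sampleB_mulVec i X d _ c
  simp only [hD.fderiv_sampleE_comm p i k]
  have hc : Continuous fun Y => (D.sampleB Y)ᵀ *ᵥ D.massB⁻¹ *ᵥ D.curlMatrixᵀ *ᵥ p :=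
    continuous_pi fun c => (hD.contDiff_sampleB_mulVec _ c).continuous
  rw [seg_add i X d (continuous_fderiv_apply (hD.contDiff_sampleE_mulVec p k) _)
    ((continuous_apply k).comp ((LinearMap.continuous_of_finiteDimensional _).comp hc)),
    seg_fderiv_self i X d (hD.contDiff_sampleE_mulVec p k), hL, seg_crossProduct]

theorem sum_seg_fderiv_sampleB {z : Phase N Ne Nb} (hz : IsWeakDiv D.Ω (D.magneticField z) 0)
    (i : Fin 3) (X : Fin 3 → ℝ) (d : ℝ) :
    ∑ k, seg (fun Y => fderiv ℝ (fun Y => ((D.sampleB Y)ᵀ *ᵥ z.2.2.2) k) Y (Pi.single k 1)) i X d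
      = 0 := by
  have h := seg_sum i X d (w := fun k Y => fderiv ℝ (fun Y => ((D.sampleB Y)ᵀ *ᵥ z.2.2.2) k) Y
    (Pi.single k 1)) (fun k => continuous_fderiv_apply (hD.contDiff_sampleB_mulVec _ k) _)
    (fun _ => 1)
  simp only [mul_one, hD.div_sampleB hz] at h
  rw [← h]
  simp [seg]

theorem hasDerivAt_lineIntegral_sampleE_line (i : Fin 3) (X ξ : Fin 3 → ℝ) (d δ : ℝ) :
    HasDerivAt (fun τ : ℝ => lineIntegral D.sampleE i (X + τ • ξ) (d + τ * δ) *ᵥ Pi.single i 1)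
      (fun j => seg (fun Y => fderiv ℝ (fun Y => D.sampleE Y j i) Y ξ) i X d
        + δ * D.sampleE (X + d • Pi.single i 1) j i) 0 := by
  refine hasDerivAt_pi.2 fun j => ?_
  simp only [mulVec_single_one, Matrix.col_apply, lineIntegral_apply]
  exact hasDerivAt_seg_joint (hD.contDiff_sampleE j i) i X ξ d δ

theorem hasDerivAt_lineIntegral_sampleB_line (i : Fin 3) (X ξ : Fin 3 → ℝ) (d δ : ℝ)
    (q β : Fin Nb → ℝ) :
    HasDerivAt (fun τ : ℝ => (lineIntegral D.sampleB i (X + τ • ξ) (d + τ * δ))ᵀ *ᵥ (q + τ • β))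
      ((fun c => seg (fun Y => fderiv ℝ (fun Y => ((D.sampleB Y)ᵀ *ᵥ q) c) Y ξ) i X d)
        + δ • (D.sampleB (X + d • Pi.single i 1))ᵀ *ᵥ q + (lineIntegral D.sampleB i X d)ᵀ *ᵥ β)
      0 := by
  refine hasDerivAt_pi.2 fun c => ?_
  have h := HasDerivAt.fun_sum (u := Finset.univ) fun j _ =>
    (hasDerivAt_seg_joint (hD.contDiff_sampleB j c) i X ξ d δ).fun_mul
      (((hasDerivAt_id' (0 : ℝ)).mul_const (β j)).const_add (q j))
  refine (h.congr_deriv ?_).congr_of_eventuallyEq (Eventually.of_forall fun τ => ?_)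
  · simp only [hD.fderiv_sampleB_mulVec]
    rw [Pi.add_apply, Pi.add_apply, seg_sum i X d fun j =>
      continuous_fderiv_apply (hD.contDiff_sampleB j c) ξ]
    simp only [Pi.smul_apply, mulVec, dotProduct, transpose_apply, lineIntegral_apply, smul_eq_mul,
      Finset.mul_sum, ← Finset.sum_add_distrib]
    refine Finset.sum_congr rfl fun j _ => ?_
    simp
    ring
  · simp only [mulVec, dotProduct, transpose_apply, lineIntegral_apply, Pi.add_apply,
      Pi.smul_apply, smul_eq_mul]

theorem hasDerivAt_flow_v_line (i : Fin 3) (t : ℝ) (z u : Phase N Ne Nb) :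
    HasDerivAt (fun τ : ℝ => D.flow (.v i) t (z + τ • u))
      (fun s => u.1 s + (t * u.2.1 s i) • Pi.single i 1,
       fun s => u.2.1 s + crossProduct (Pi.single i 1)
        ((fun c => seg (fun Y => fderiv ℝ (fun Y => ((D.sampleB Y)ᵀ *ᵥ z.2.2.2) c) Y (u.1 s)) i
            (z.1 s) (t * z.2.1 s i))
          + (t * u.2.1 s i) • (D.sampleB (z.1 s + (t * z.2.1 s i) • Pi.single i 1))ᵀ *ᵥ z.2.2.2
          + (lineIntegral D.sampleB i (z.1 s) (t * z.2.1 s i))ᵀ *ᵥ u.2.2.2),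
       u.2.2.1 - D.massE⁻¹ *ᵥ ∑ s, D.weight s • fun j =>
          seg (fun Y => fderiv ℝ (fun Y => D.sampleE Y j i) Y (u.1 s)) i (z.1 s) (t * z.2.1 s i)
          + (t * u.2.1 s i) * D.sampleE (z.1 s + (t * z.2.1 s i) • Pi.single i 1) j i,
       u.2.2.2) 0 := by
  have hid : ∀ {E : Type} [NormedAddCommGroup E] [NormedSpace ℝ E] (a b : E),
      HasDerivAt (fun τ : ℝ => a + τ • b) b 0 := by
    intro E _ _ a b
    simpa using ((hasDerivAt_id' (0 : ℝ)).smul_const b).const_add a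
  -- The length of each segment is itself a function of the state, which is the source of the
  -- endpoint terms.
  have hlen : ∀ (τ : ℝ) s, t * (z + τ • u).2.1 s i = t * z.2.1 s i + τ * (t * u.2.1 s i) := by
    intro τ s
    simp only [Prod.snd_add, Prod.fst_add, Prod.smul_snd, Prod.smul_fst, Pi.add_apply,
      Pi.smul_apply, smul_eq_mul]
    ring
  refine HasDerivAt.prodMk (hasDerivAt_pi.2 fun s => ?_) (HasDerivAt.prodMk
    (hasDerivAt_pi.2 fun s => ?_) (HasDerivAt.prodMk ?_ (hid z.2.2.2 u.2.2.2)))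
  · simp only [hlen]
    refine (hid (z.1 s) (u.1 s)).fun_add (HasDerivAt.smul_const ?_ _)
    simpa using hid (t * z.2.1 s i) (t * u.2.1 s i)
  · simp only [hlen]
    exact (hid (z.2.1 s) (u.2.1 s)).fun_add (HasDerivAt.linearMap_comp _
      (hD.hasDerivAt_lineIntegral_sampleB_line i (z.1 s) (u.1 s) (t * z.2.1 s i) (t * u.2.1 s i)
        z.2.2.2 u.2.2.2))
  · simp only [hlen]
    exact (hid z.2.2.1 u.2.2.1).fun_sub (HasDerivAt.linearMap_comp D.massE⁻¹.mulVecLin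
      (HasDerivAt.fun_sum (u := Finset.univ) fun s _ => HasDerivAt.fun_const_smul (D.weight s)
        (hD.hasDerivAt_lineIntegral_sampleE_line i (z.1 s) (u.1 s) (t * z.2.1 s i)
          (t * u.2.1 s i))))

omit hD in
theorem dotProduct_massE_inv_mulVec (e a : Fin Ne → ℝ) :
    e ⬝ᵥ D.massE⁻¹ *ᵥ a = ∑ j, a j * (D.massE⁻¹ *ᵥ e) j := by
  rw [dotProduct_comm, massE_inv_dotProduct_comm, dotProduct_comm]
  rfl

/-- The `B_D`-gradient is given only in paired form, since in `bracket_eq` it occurs only in such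
pairings. -/
theorem grad_comp_flow_v (i : Fin 3) (t : ℝ) {F : Phase N Ne Nb → ℝ} (hF : ContDiff ℝ ∞ F)
    (z : Phase N Ne Nb) :
    (∀ s k, gradX (fun y => F (D.flow (.v i) t y)) z s k = gradX F (D.flow (.v i) t z) s k
      + gradV F (D.flow (.v i) t z) s ⬝ᵥ crossProduct (Pi.single i 1) (fun c =>
          seg (fun Y => fderiv ℝ (fun Y => ((D.sampleB Y)ᵀ *ᵥ z.2.2.2) c) Y (Pi.single k 1)) i
            (z.1 s) (t * z.2.1 s i))
      - D.weight s * seg (fun Y => fderiv ℝ (fun Y => ((D.sampleE Y)ᵀ *ᵥ D.massE⁻¹ *ᵥ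
            gradE F (D.flow (.v i) t z)) i) Y (Pi.single k 1)) i (z.1 s) (t * z.2.1 s i)) ∧
    (∀ s, gradV (fun y => F (D.flow (.v i) t y)) z s = gradV F (D.flow (.v i) t z) s
      + (t * (gradX F (D.flow (.v i) t z) s i
        + gradV F (D.flow (.v i) t z) s ⬝ᵥ crossProduct (Pi.single i 1)
          ((D.sampleB (z.1 s + (t * z.2.1 s i) • Pi.single i 1))ᵀ *ᵥ z.2.2.2)
        - D.weight s * ((D.sampleE (z.1 s + (t * z.2.1 s i) • Pi.single i 1))ᵀ *ᵥ D.massE⁻¹ *ᵥ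
            gradE F (D.flow (.v i) t z)) i)) • (Pi.single i 1 : Fin 3 → ℝ)) ∧
    gradE (fun y => F (D.flow (.v i) t y)) z = gradE F (D.flow (.v i) t z) ∧
    (∀ p : Fin Nb → ℝ, p ⬝ᵥ gradB (fun y => F (D.flow (.v i) t y)) z
      = p ⬝ᵥ gradB F (D.flow (.v i) t z) + ∑ s, gradV F (D.flow (.v i) t z) s ⬝ᵥ
          crossProduct (Pi.single i 1)
            ((lineIntegral D.sampleB i (z.1 s) (t * z.2.1 s i))ᵀ *ᵥ p)) := by
  have h := fun u => fderiv_comp_of_line hF (hD.contDiff_flow (.v i) t)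
    (hD.hasDerivAt_flow_v_line i t z u)
  have h3 : ((fun _ => 0) : Fin 3 → ℝ) = 0 := rfl
  have he : ((fun _ => 0) : Fin Ne → ℝ) = 0 := rfl
  have hs0 : ∀ X d, seg (fun _ => (0 : ℝ)) i X d = 0 := fun X d => by simp [seg]
  refine ⟨?_, ?_, ?_, ?_⟩
  · intro s k
    rw [gradX, h]
    simp only [Pi.zero_apply, mul_zero, zero_smul, zero_mul, add_zero, zero_add, mulVec_zero,
      dotProduct_zero, zero_sub]
    rw [Finset.sum_eq_single s (by intro r _ hr; simp [hr]) (by simp),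
      Finset.sum_eq_single s (by
        intro r _ hr
        simp only [Pi.single_eq_of_ne hr, map_zero, hs0, h3, dotProduct_zero]) (by simp),
      Finset.sum_eq_single s (by
        intro r _ hr
        simp only [Pi.single_eq_of_ne hr, map_zero, hs0, he, smul_zero]) (by simp)]
    simp only [Pi.single_eq_same, dotProduct_single, mul_one, mulVec_smul, dotProduct_neg,
      dotProduct_smul, smul_eq_mul, dotProduct_massE_inv_mulVec, hD.fderiv_sampleE_mulVec]
    rw [seg_sum i _ _ fun j => continuous_fderiv_apply (hD.contDiff_sampleE j i) _]
    ring
  · intro s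
    refine eq_of_dotProduct_single fun k => ?_
    rw [gradV, h]
    simp only [Pi.zero_apply, mulVec_zero, map_zero, hs0, h3, zero_add, add_zero,
      dotProduct_zero, zero_sub]
    rw [Finset.sum_eq_single s (by intro r _ hr; simp [hr]) (by simp),
      Finset.sum_eq_single s (by intro r _ hr; simp [hr]) (by simp),
      Finset.sum_eq_single s (by
        intro r _ hr
        simp only [Pi.single_eq_of_ne hr, Pi.zero_apply, mul_zero, zero_mul, he, smul_zero])
        (by simp)]
    simp only [Pi.single_eq_same, dotProduct_single, mul_one, mulVec_smul, dotProduct_neg,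
      dotProduct_smul, smul_eq_mul, dotProduct_massE_inv_mulVec, sampleE_transpose_mulVec,
      dotProduct_add, map_smul, Pi.add_apply, Pi.smul_apply, mul_assoc, ← Finset.mul_sum]
    have hki : (Pi.single k 1 : Fin 3 → ℝ) i = (Pi.single i 1 : Fin 3 → ℝ) k := by
      simp [Pi.single_apply, eq_comm]
    rw [hki]
    ring
  · funext j
    rw [gradE, h]
    simp [gradE, hs0, h3, he]
  · intro p
    have hp : p ⬝ᵥ gradB (fun y => F (D.flow (.v i) t y)) z
        = fderiv ℝ (fun y => F (D.flow (.v i) t y)) z (0, 0, 0, p) := by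
      rw [fderiv_apply_eq]; simp [dotProduct_comm]
    rw [hp, h]
    simp [hs0, h3, he, dotProduct_comm p]
    ring

/-- The `E_D`-gradient is unchanged and the correction to the `B_D`-gradient is a sum over
particles, so apart from the common field term the claim decouples into one identity per particle.
-/
theorem bracket_flow_v (i : Fin 3) (t : ℝ) {F G : Phase N Ne Nb → ℝ} (hF : ContDiff ℝ ∞ F)
    (hG : ContDiff ℝ ∞ G) {z : Phase N Ne Nb} (hz : IsWeakDiv D.Ω (D.magneticField z) 0) :
    D.bracket (fun y => F (D.flow (.v i) t y)) (fun y => G (D.flow (.v i) t y)) z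
      = D.bracket F G (D.flow (.v i) t z) := by
  obtain ⟨f1, f2, f3, f4⟩ := hD.grad_comp_flow_v i t hF z
  obtain ⟨g1, g2, g3, g4⟩ := hD.grad_comp_flow_v i t hG z
  rw [bracket_eq, bracket_eq, f3, g3, f4, g4]
  have key := fun s => single_particle_identity i (hD.weight_ne_zero s) t
    _ _ _ _ ((D.sampleE (z.1 s))ᵀ *ᵥ D.massE⁻¹ *ᵥ gradE F (D.flow (.v i) t z))
    ((D.sampleE (z.1 s))ᵀ *ᵥ D.massE⁻¹ *ᵥ gradE G (D.flow (.v i) t z)) _ _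
    ((lineIntegral D.sampleB i (z.1 s) (t * z.2.1 s i))ᵀ *ᵥ D.massB⁻¹ *ᵥ D.curlMatrixᵀ *ᵥ
      D.massE⁻¹ *ᵥ gradE F (D.flow (.v i) t z))
    ((lineIntegral D.sampleB i (z.1 s) (t * z.2.1 s i))ᵀ *ᵥ D.massB⁻¹ *ᵥ D.curlMatrixᵀ *ᵥ
      D.massE⁻¹ *ᵥ gradE G (D.flow (.v i) t z))
    ((D.sampleB (z.1 s))ᵀ *ᵥ z.2.2.2) _ _ _ _ _
    (fun k c => seg (fun Y => fderiv ℝ (fun Y => ((D.sampleB Y)ᵀ *ᵥ z.2.2.2) c) Y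
      (Pi.single k 1)) i (z.1 s) (t * z.2.1 s i))
    -- The two conditions on `T`: the fundamental theorem of calculus along the path, and the path
    -- integral of the vanishing divergence.
    (fun c => seg_fderiv_self i (z.1 s) (t * z.2.1 s i) (hD.contDiff_sampleB_mulVec _ c))
    (hD.sum_seg_fderiv_sampleB hz i (z.1 s) (t * z.2.1 s i))
    (fun k => (f1 s k).trans (by rw [hD.seg_fderiv_sampleE]))
    (fun k => (g1 s k).trans (by rw [hD.seg_fderiv_sampleE])) (f2 s) (g2 s)
  have hX : ∀ s, (D.flow (.v i) t z).1 s = z.1 s + (t * z.2.1 s i) • Pi.single i 1 := fun _ => rfl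
  have hB : (D.flow (.v i) t z).2.2.2 = z.2.2.2 := rfl
  simp only [hX, hB, ← key, Finset.sum_add_distrib, Finset.sum_sub_distrib]
  ring

theorem bracket_flow (k : Part) (t : ℝ) {F G : Phase N Ne Nb → ℝ} (hF : ContDiff ℝ ∞ F)
    (hG : ContDiff ℝ ∞ G) {z : Phase N Ne Nb} (hz : IsWeakDiv D.Ω (D.magneticField z) 0) :
    D.bracket (fun y => F (D.flow k t y)) (fun y => G (D.flow k t y)) z
      = D.bracket F G (D.flow k t z) := by
  cases k with
  | E => exact hD.bracket_flow_E t hF hG z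
  | B => exact hD.bracket_flow_B t hF hG z
  | v i => exact hD.bracket_flow_v i t hF hG hz

/-- The outermost map is absorbed into `F` and `G` for the induction; its own invariance is then
used at the image under the inner maps, which is again divergence-free. -/
theorem bracket_compose (l : List (Part × ℝ)) {F G : Phase N Ne Nb → ℝ} (hF : ContDiff ℝ ∞ F)
    (hG : ContDiff ℝ ∞ G) {z : Phase N Ne Nb} (hz : IsWeakDiv D.Ω (D.magneticField z) 0) :
    D.bracket (fun y => F (D.compose l y)) (fun y => G (D.compose l y)) z
      = D.bracket F G (D.compose l z) := by
  induction l generalizing F G with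
  | nil => rfl
  | cons a l ih =>
    have hΦ := hD.contDiff_flow a.1 a.2
    exact (ih (hF.comp hΦ) (hG.comp hΦ)).trans
      (hD.bracket_flow a.1 a.2 hF hG (hD.isWeakDiv_compose l hz))

end Admissible

end Discretisation

/-! ### Second-order expansions of curves -/

section Jets

variable {E : Type*} [NormedAddCommGroup E] [NormedSpace ℝ E]

/-- `y h = z + h A + h² B + O(h³)` as `h → 0`. -/
def HasJet (y : ℝ → E) (z A B : E) : Prop :=
  (fun h => y h - (z + h • A + h ^ 2 • B)) =O[𝓝 (0 : ℝ)] fun h => h ^ 3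

/-- The mean value inequality on a symmetric interval, so that both signs of `t` are covered at
once. -/
theorem norm_sub_le_of_hasDerivAt_le {R R' : ℝ → E} {t C : ℝ}
    (hR : ∀ s, |s| ≤ |t| → HasDerivAt R (R' s) s) (hC : ∀ s, |s| ≤ |t| → ‖R' s‖ ≤ C)
    (h0 : R 0 = 0) : ‖R t‖ ≤ C * |t| := by
  have hmem : ∀ s, s ∈ Metric.closedBall (0 : ℝ) |t| ↔ |s| ≤ |t| := fun s => by simp
  have h := (convex_closedBall (0 : ℝ) |t|).norm_image_sub_le_of_norm_hasDerivWithin_le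
    (fun s hs => (hR s ((hmem s).1 hs)).hasDerivWithinAt) (fun s hs => hC s ((hmem s).1 hs))
    ((hmem 0).2 (by simp)) ((hmem t).2 le_rfl)
  simpa [h0] using h

/-- The second-order Taylor formula for a solution of `u' = f(u)`. -/
theorem norm_solution_sub_le {f : E → E} (hf : ContDiff ℝ ∞ f) {u : ℝ → E} {y : E} {t K : ℝ}
    (hK : 0 ≤ K) (h0 : u 0 = y) (hu : ∀ s, |s| ≤ |t| → HasDerivAt u (f (u s)) s)
    (hq : ∀ s, |s| ≤ |t| → ‖fderiv ℝ f (u s) (f (u s)) - fderiv ℝ f y (f y)‖ ≤ K * |s|) :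
    ‖u t - (y + t • f y + (t ^ 2 / 2) • fderiv ℝ f y (f y))‖ ≤ K * |t| ^ 3 := by
  -- The second derivative of `u` is `f'(u) f(u)`. Its deviation from the initial value is
  -- integrated twice, each time crudely bounded by its maximum, so no factorial appears in the
  -- constant.
  have h1 : ∀ r, |r| ≤ |t| → ‖f (u r) - f y - r • fderiv ℝ f y (f y)‖ ≤ K * |t| * |r| := by
    intro r hr
    refine norm_sub_le_of_hasDerivAt_le
      (R := fun r => f (u r) - f y - r • fderiv ℝ f y (f y))
      (R' := fun s => fderiv ℝ f (u s) (f (u s)) - fderiv ℝ f y (f y)) (fun s hs => ?_)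
      (fun s hs => (hq s (hs.trans hr)).trans
        (mul_le_mul_of_nonneg_left (hs.trans hr) hK)) (by simp [h0])
    have hd := ((hf.differentiable (by simp) (u s)).hasFDerivAt.comp_hasDerivAt s
      (hu s (hs.trans hr))).sub_const (f y)
    refine (hd.sub ((hasDerivAt_id' s).smul_const (fderiv ℝ f y (f y)))).congr_deriv ?_
    simp
  have h2 := norm_sub_le_of_hasDerivAt_le (t := t) (C := K * |t| * |t|)
    (R := fun r => u r - (y + r • f y + (r ^ 2 / 2) • fderiv ℝ f y (f y)))
    (R' := fun s => f (u s) - f y - s • fderiv ℝ f y (f y)) (fun s hs => ?_)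
    (fun s hs => (h1 s hs).trans (mul_le_mul_of_nonneg_left hs (by positivity))) (by simp [h0])
  · refine h2.trans (le_of_eq (by ring))
  · have e1 : HasDerivAt (fun r : ℝ => r ^ 2 / 2) s s := by
      have := ((hasDerivAt_id' s).fun_pow 2).div_const 2
      refine this.congr_deriv ?_
      simp
    refine ((hu s hs).sub ((((hasDerivAt_id' s).smul_const (f y)).const_add y).add
      (e1.smul_const (fderiv ℝ f y (f y))))).congr_deriv ?_
    rw [one_smul]
    abel

theorem contDiff_fderiv_apply_self {f : E → E} (hf : ContDiff ℝ ∞ f) :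
    ContDiff ℝ ∞ fun y => fderiv ℝ f y (f y) :=
  (hf.fderiv_right (m := ∞) (by simp)).clm_apply hf

/-- No higher regularity of `u` is required: `f'f` composed with `u` is differentiable at 0, so its
increment is `O(s)`. -/
theorem hasJet_of_solution {f : E → E} (hf : ContDiff ℝ ∞ f) {u : ℝ → E}
    (hu : ∀ᶠ t in 𝓝 (0 : ℝ), HasDerivAt u (f (u t)) t) :
    HasJet u (u 0) (f (u 0)) ((1 / 2 : ℝ) • fderiv ℝ f (u 0) (f (u 0))) := by
  have hq := ((contDiff_fderiv_apply_self hf).differentiable (by simp) (u 0)).comp (0 : ℝ)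
    hu.self_of_nhds.differentiableAt
  obtain ⟨K, hK, hb⟩ := hq.hasDerivAt.isBigO_sub.exists_pos
  obtain ⟨δ, hδ, hball⟩ := Metric.eventually_nhds_iff.1 (hu.and hb.bound)
  refine Asymptotics.IsBigO.of_bound K ?_
  filter_upwards [Metric.ball_mem_nhds (0 : ℝ) hδ] with t ht
  have hs : ∀ s, |s| ≤ |t| → dist s 0 < δ := fun s hs => by
    rw [Real.dist_0_eq_abs]
    rw [Metric.mem_ball, Real.dist_0_eq_abs] at ht
    exact hs.trans_lt ht
  have := norm_solution_sub_le hf hK.le rfl (fun s h => (hball (hs s h)).1) (t := t) (fun s h => by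
    simpa using (hball (hs s h)).2)
  rw [norm_pow, Real.norm_eq_abs]
  refine (le_of_eq ?_).trans this
  rw [smul_smul]
  congr 4
  ring

/-- The expansion is uniform in the starting point near `z`, because in a composition each substep
starts from a point that moves with `h`. A local Lipschitz constant in `(t, y)` supplies this. -/
theorem isBigO_flow_sub {f : E → E} (hf : ContDiff ℝ ∞ f) {Φ : ℝ → E → E}
    (hΦ : ContDiff ℝ ∞ fun q : ℝ × E => Φ q.1 q.2)
    (hode : ∀ t y, HasDerivAt (fun τ => Φ τ y) (f (Φ t y)) t) (h0 : ∀ y, Φ 0 y = y) (z : E) :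
    (fun q : ℝ × E => Φ q.1 q.2
      - (q.2 + q.1 • f q.2 + (q.1 ^ 2 / 2) • fderiv ℝ f q.2 (f q.2))) =O[𝓝 (0, z)]
      fun q => q.1 ^ 3 := by
  have hq := (contDiff_fderiv_apply_self hf).comp hΦ
  obtain ⟨K, s, hs, hL⟩ := ((hq.of_le (m := 1) (by simp)).contDiffAt
    (x := ((0 : ℝ), z))).exists_lipschitzOnWith
  obtain ⟨δ, hδ, hball⟩ := Metric.mem_nhds_iff.1 hs
  refine Asymptotics.IsBigO.of_bound K ?_
  filter_upwards [Metric.ball_mem_nhds ((0 : ℝ), z) hδ] with q hqm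
  obtain ⟨t, y⟩ := q
  rw [← ball_prod_same, Set.mem_prod, Metric.mem_ball, Real.dist_0_eq_abs] at hqm
  have hmem : ∀ r, |r| ≤ |t| → (r, y) ∈ s := fun r hr => hball (by
    rw [← ball_prod_same, Set.mem_prod, Metric.mem_ball, Real.dist_0_eq_abs]
    exact ⟨hr.trans_lt hqm.1, hqm.2⟩)
  have := norm_solution_sub_le hf K.2 (h0 y) (t := t) (fun r _ => hode r y) (fun r hr => by
    have := hL.dist_le_mul _ (hmem r hr) _ (hmem 0 (by simp))
    simpa [Function.comp, dist_eq_norm, Prod.norm_def, h0] using this)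
  simpa [norm_pow] using this

theorem isBigO_sub_fderiv {f : E → E} (hf : ContDiff ℝ ∞ f) (z : E) :
    (fun y => f y - f z - fderiv ℝ f z (y - z)) =O[𝓝 z] fun y => ‖y - z‖ ^ 2 := by
  obtain ⟨K, s, hs, hL⟩ := (((hf.fderiv_right (m := ∞) (by simp)).of_le (m := 1)
    (by simp)).contDiffAt (x := z)).exists_lipschitzOnWith
  obtain ⟨δ, hδ, hball⟩ := Metric.mem_nhds_iff.1 hs
  refine Asymptotics.IsBigO.of_bound K ?_
  filter_upwards [Metric.ball_mem_nhds z hδ] with y hy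
  have hmem : ∀ x ∈ Metric.closedBall z ‖y - z‖, x ∈ s := fun x hx => hball (by
    rw [Metric.mem_ball, dist_eq_norm] at hy ⊢
    rw [Metric.mem_closedBall, dist_eq_norm] at hx
    exact hx.trans_lt hy)
  have := (convex_closedBall z ‖y - z‖).norm_image_sub_le_of_norm_fderiv_le' (𝕜 := ℝ) (f := f)
    (φ := fderiv ℝ f z) (C := K * ‖y - z‖) (fun x _ => hf.differentiable (by simp) x)
    (fun x hx => by
      have h1 := hL.dist_le_mul _ (hmem x hx) _ (hmem z (by simp))
      rw [dist_eq_norm, dist_eq_norm] at h1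
      rw [Metric.mem_closedBall, dist_eq_norm] at hx
      exact h1.trans (mul_le_mul_of_nonneg_left hx K.2))
    (Metric.mem_closedBall_self (norm_nonneg _)) (by simp [dist_eq_norm] : y ∈ _)
  refine this.trans (le_of_eq ?_)
  rw [norm_pow, norm_norm]; ring

theorem isBigO_pow_pow {m n : ℕ} (h : n ≤ m) :
    (fun h : ℝ => h ^ m) =O[𝓝 (0 : ℝ)] fun h => h ^ n := by
  obtain ⟨k, rfl⟩ := Nat.exists_eq_add_of_le h
  simp only [pow_add]
  have : (fun h : ℝ => h ^ k) =O[𝓝 (0 : ℝ)] fun _ => (1 : ℝ) :=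
    ((continuous_pow k).tendsto 0).isBigO_one ℝ
  simpa using (Asymptotics.isBigO_refl (fun h : ℝ => h ^ n) (𝓝 0)).mul this

theorem isBigO_pow_smul_const (n : ℕ) (v : E) :
    (fun h : ℝ => h ^ n • v) =O[𝓝 (0 : ℝ)] fun h => h ^ n :=
  Asymptotics.IsBigO.of_bound ‖v‖ (Eventually.of_forall fun h => by
    rw [norm_smul, mul_comm])

theorem HasJet.isBigO_sub_linear {y : ℝ → E} {z A B : E} (h : HasJet y z A B) :
    (fun h => y h - z - h • A) =O[𝓝 (0 : ℝ)] fun h => h ^ 2 := by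
  have := (h.trans (isBigO_pow_pow (by norm_num : 2 ≤ 3))).add (isBigO_pow_smul_const 2 B)
  refine this.congr_left fun h => ?_
  abel

theorem HasJet.isBigO_sub {y : ℝ → E} {z A B : E} (h : HasJet y z A B) :
    (fun h => y h - z) =O[𝓝 (0 : ℝ)] fun h => h ^ 1 := by
  have := (h.isBigO_sub_linear.trans (isBigO_pow_pow (by norm_num : 1 ≤ 2))).add
    (isBigO_pow_smul_const 1 A)
  refine this.congr_left fun h => ?_
  simp

theorem HasJet.tendsto {y : ℝ → E} {z A B : E} (h : HasJet y z A B) : Tendsto y (𝓝 0) (𝓝 z) := by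
  have h1 := h.isBigO_sub.trans_tendsto (by
    simpa using (continuous_pow (M := ℝ) 1).tendsto 0)
  simpa using h1.add_const z

theorem hasJet_const (z : E) : HasJet (fun _ => z) z 0 0 := by
  refine (Asymptotics.isBigO_zero _ _).congr_left fun h => ?_
  simp

/-- The effect of one substep on a second-order expansion. -/
theorem HasJet.flow {f : E → E} (hf : ContDiff ℝ ∞ f) {Φ : ℝ → E → E}
    (hΦ : ContDiff ℝ ∞ fun q : ℝ × E => Φ q.1 q.2)
    (hode : ∀ t y, HasDerivAt (fun τ => Φ τ y) (f (Φ t y)) t) (h0 : ∀ y, Φ 0 y = y)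
    {y : ℝ → E} {z A B : E} (hy : HasJet y z A B) (c : ℝ) :
    HasJet (fun h => Φ (h * c) (y h)) z (A + c • f z)
      (B + c • fderiv ℝ f z A + (c ^ 2 / 2) • fderiv ℝ f z (f z)) := by
  have ht : Tendsto (fun h : ℝ => (h * c, y h)) (𝓝 0) (𝓝 (0, z)) := by
    refine Tendsto.prodMk_nhds ?_ hy.tendsto
    simpa using (continuous_mul_const c).tendsto (0 : ℝ)
  -- `t1` expands the substep about the moving point `y h`; `t2` and `t3` then replace the values at
  -- `y h` by their expansions about `z`, to the accuracy that the prefactors `h` and `h²` require.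
  have t1 : (fun h : ℝ => Φ (h * c) (y h) - (y h + (h * c) • f (y h)
      + ((h * c) ^ 2 / 2) • fderiv ℝ f (y h) (f (y h)))) =O[𝓝 0] fun h => h ^ 3 := by
    refine ((isBigO_flow_sub hf hΦ hode h0 z).comp_tendsto ht).trans ?_
    refine Asymptotics.IsBigO.of_bound (‖c‖ ^ 3) (Eventually.of_forall fun h => le_of_eq ?_)
    simp [mul_pow, mul_comm]
  have t2 : (fun h : ℝ => f (y h) - f z - h • fderiv ℝ f z A) =O[𝓝 0] fun h => h ^ 2 := by
    have a1 := ((isBigO_sub_fderiv hf z).comp_tendsto hy.tendsto).trans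
      (k := fun h : ℝ => h ^ 2) ?_
    · have a2 := ((fderiv ℝ f z).isBigO_comp (fun h : ℝ => y h - z - h • A) (𝓝 0)).trans
        hy.isBigO_sub_linear
      refine (a1.add a2).congr_left fun h => ?_
      simp
    · have a0 : (fun h => ‖y h - z‖ ^ 2) =O[𝓝 (0 : ℝ)] fun h => h ^ 2 := by
        simpa using hy.isBigO_sub.norm_left.pow 2
      exact a0
  have t3 : (fun h : ℝ => fderiv ℝ f (y h) (f (y h)) - fderiv ℝ f z (f z)) =O[𝓝 0]
      fun h => h ^ 1 := by
    have hd := ((contDiff_fderiv_apply_self hf).differentiable (by simp) z).hasFDerivAt.isBigO_sub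
    exact (hd.comp_tendsto hy.tendsto).trans hy.isBigO_sub
  have s2 := ((isBigO_pow_smul_const 1 c).smul t2).congr_right
    (g₂ := fun h : ℝ => h ^ 3) fun h => by simp; ring
  have s3 := ((isBigO_pow_smul_const 2 (c ^ 2 / 2)).smul t3).congr_right
    (g₂ := fun h : ℝ => h ^ 3) fun h => by simp; ring
  refine (((t1.add hy).add s2).add s3).congr_left fun h => ?_
  simp only [smul_eq_mul, pow_one]
  module

theorem HasJet.isBigO_sub_of_eq {y y' : ℝ → E} {z A B : E} (h : HasJet y z A B)
    (h' : HasJet y' z A B) : (fun h => y h - y' h) =O[𝓝 (0 : ℝ)] fun h => h ^ 3 := by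
  refine (h.sub h').congr_left fun h => ?_
  abel

theorem HasJet.isBigO_sub_of_linear_eq {y y' : ℝ → E} {z A B B' : E} (h : HasJet y z A B)
    (h' : HasJet y' z A B') : (fun h => y h - y' h) =O[𝓝 (0 : ℝ)] fun h => h ^ 2 := by
  refine (h.isBigO_sub_linear.sub h'.isBigO_sub_linear).congr_left fun h => ?_
  abel

end Jets

/-! ### The orders of the two schemes -/

namespace Discretisation

variable {N Ne Nb : ℕ} {D : Discretisation N Ne Nb}

namespace Admissible

variable (hD : D.Admissible)

include hD

theorem hasJet_flow (k : Part) {y : ℝ → Phase N Ne Nb} {z A B : Phase N Ne Nb}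
    (hy : HasJet y z A B) (c : ℝ) :
    HasJet (fun h => D.flow k (h * c) (y h)) z (A + c • D.partField k z)
      (B + c • fderiv ℝ (D.partField k) z A
        + (c ^ 2 / 2) • fderiv ℝ (D.partField k) z (D.partField k z)) :=
  hy.flow (hD.contDiff_partField k) (hD.contDiff_uncurry_flow k)
    (fun t y => hD.hasDerivAt_flow k y t) (flow_zero k) c

theorem exists_isLocalSolution (z : Phase N Ne Nb) : ∃ γ, D.IsLocalSolution z γ := by
  obtain ⟨γ, h0, ε, hε, h⟩ := ((hD.contDiff_field.of_le (m := 1) (by simp)).contDiffAt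
    (x := z)).exists_forall_mem_closedBall_exists_eq_forall_mem_Ioo_hasDerivAt₀ 0
  refine ⟨γ, h0, ?_⟩
  filter_upwards [Ioo_mem_nhds (show (0 : ℝ) - ε < 0 by linarith) (show (0 : ℝ) < 0 + ε by linarith)]
    with t ht using h t ht

theorem fderiv_field (z : Phase N Ne Nb) :
    fderiv ℝ D.field z = fderiv ℝ (D.partField .E) z + fderiv ℝ (D.partField .B) z
      + fderiv ℝ (D.partField (.v 0)) z + fderiv ℝ (D.partField (.v 1)) z
      + fderiv ℝ (D.partField (.v 2)) z := by
  have hd : ∀ k, HasFDerivAt (D.partField k) (fderiv ℝ (D.partField k) z) z := fun k =>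
    ((hD.contDiff_partField k).differentiable (by simp) z).hasFDerivAt
  rw [funext D.field_eq_sum]
  exact (((((hd _).add (hd _)).add (hd _)).add (hd _)).add (hd _)).fderiv

theorem hasJet_solution {z : Phase N Ne Nb} {γ : ℝ → Phase N Ne Nb} (h : D.IsLocalSolution z γ) :
    HasJet γ z (D.field z) ((1 / 2 : ℝ) • fderiv ℝ D.field z (D.field z)) := by
  have := hasJet_of_solution hD.contDiff_field h.2
  rwa [h.1] at this

theorem hasOrder_firstOrderScheme : D.HasOrder 1 D.firstOrderScheme := by
  intro z γ hγ
  have h := hD.hasJet_flow .E (hD.hasJet_flow .B (hD.hasJet_flow (.v 0) (hD.hasJet_flow (.v 1)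
    (hD.hasJet_flow (.v 2) (hasJet_const z) 1) 1) 1) 1) 1
  simp only [mul_one] at h
  -- Order one needs only equal linear coefficients; the quadratic ones may differ.
  refine HasJet.isBigO_sub_of_linear_eq h (B' := (1 / 2 : ℝ) • fderiv ℝ D.field z (D.field z)) ?_
  convert hD.hasJet_solution hγ using 1
  rw [field_eq_sum]
  module

theorem hasOrder_secondOrderScheme : D.HasOrder 2 D.secondOrderScheme := by
  intro z γ hγ
  have h := hD.hasJet_flow .E (hD.hasJet_flow .B (hD.hasJet_flow (.v 0) (hD.hasJet_flow (.v 1)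
    (hD.hasJet_flow (.v 2) (hD.hasJet_flow (.v 1) (hD.hasJet_flow (.v 0) (hD.hasJet_flow .B
    (hD.hasJet_flow .E (hasJet_const z) (1 / 2)) (1 / 2)) (1 / 2)) (1 / 2)) 1) (1 / 2)) (1 / 2))
    (1 / 2)) (1 / 2)
  simp only [mul_one, mul_one_div] at h
  refine HasJet.isBigO_sub_of_eq h ?_
  convert hD.hasJet_solution hγ using 1
  · rw [field_eq_sum]
    module
  -- Both quadratic coefficients equal half the sum of `f_k' f_l` over all ordered pairs of parts;
  -- the palindromic order balances the pairs `(k, l)` and `(l, k)`.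
  · rw [hD.fderiv_field, field_eq_sum]
    simp only [_root_.add_apply, map_add, map_smul, map_zero]
    module

end Admissible

end Discretisation

end VMPIC

end

theorem mainTheorem3 {N Ne Nb : ℕ} (D : VMPIC.Discretisation N Ne Nb)
    (hΩ : IsOpen D.Ω) (hΩb : Bornology.IsBounded D.Ω)
    (hS : ContDiff ℝ ∞ D.S) (hω : ∀ s, D.weight s ≠ 0)
    (hWe : LinearIndependent ℝ D.We) (hWb : LinearIndependent ℝ D.Wb)
    (hE : (D.Eh : Set (VMPIC.L2Vec D.Ω)) ⊆ VMPIC.electricSpace D.Ω)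
    (hB : (D.Bh : Set (VMPIC.L2Vec D.Ω)) ⊆ VMPIC.magneticSpace D.Ω)
    (hcurl : ∀ F ∈ D.Eh, VMPIC.weakCurl D.Ω F ∈ D.Bh) :
    -- the splitting of the Hamiltonian and of the system
    (∀ z, D.hamiltonian z = D.partHamiltonian .E z + D.partHamiltonian .B z
      + D.partHamiltonian (.v 0) z + D.partHamiltonian (.v 1) z + D.partHamiltonian (.v 2) z) ∧
    (∀ (I : Set ℝ) (γ : ℝ → VMPIC.Phase N Ne Nb),
      D.SolvesBracket D.hamiltonian I γ ↔ ∀ t ∈ I, HasDerivAt γ (D.field (γ t)) t) ∧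
    (∀ (k : VMPIC.Part) (I : Set ℝ) (γ : ℝ → VMPIC.Phase N Ne Nb),
      D.SolvesBracket (D.partHamiltonian k) I γ ↔
        ∀ t ∈ I, HasDerivAt γ (D.partField k (γ t)) t) ∧
    -- the update maps are the exact solutions of the subsystems
    (∀ (k : VMPIC.Part) (z : VMPIC.Phase N Ne Nb) (I : Set ℝ) (γ : ℝ → VMPIC.Phase N Ne Nb),
      IsOpen I → I.OrdConnected → (0 : ℝ) ∈ I →
        ((γ 0 = z ∧ D.SolvesBracket (D.partHamiltonian k) I γ) ↔
          ∀ t ∈ I, γ t = D.flow k t z)) ∧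
    -- the subsystems do not change the divergence of the magnetic field
    (∀ (k : VMPIC.Part) (t : ℝ) (z : VMPIC.Phase N Ne Nb) (g : VMPIC.L2Scal D.Ω),
      VMPIC.IsWeakDiv D.Ω (D.magneticField (D.flow k t z)) g ↔
        VMPIC.IsWeakDiv D.Ω (D.magneticField z) g) ∧
    -- compositions keep the magnetic field divergence-free in all steps
    (∀ (l : List (VMPIC.Part × ℝ)) (z : VMPIC.Phase N Ne Nb),
      VMPIC.IsWeakDiv D.Ω (D.magneticField z) 0 →
        ∀ n : ℕ, VMPIC.IsWeakDiv D.Ω (D.magneticField ((D.compose l)^[n] z)) 0) ∧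
    -- compositions are smooth and preserve the bracket at all divergence-free states
    (∀ l : List (VMPIC.Part × ℝ), ContDiff ℝ ∞ (D.compose l) ∧
      ∀ F G : VMPIC.Phase N Ne Nb → ℝ, ContDiff ℝ ∞ F → ContDiff ℝ ∞ G →
        ∀ z, VMPIC.IsWeakDiv D.Ω (D.magneticField z) 0 →
          D.bracket (fun y => F (D.compose l y)) (fun y => G (D.compose l y)) z
            = D.bracket F G (D.compose l z)) ∧
    -- the two schemes: orders of accuracy, and symmetry of the second
    (∀ z, ∃ γ, D.IsLocalSolution z γ) ∧
    D.HasOrder 1 D.firstOrderScheme ∧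
    D.HasOrder 2 D.secondOrderScheme ∧
    (∀ h z, D.secondOrderScheme h (D.secondOrderScheme (-h) z) = z) := by
  have hD : D.Admissible := ⟨hΩ, hΩb, hS, hω, hWe, hWb, hE, hB, hcurl⟩
  have hMe := hD.isUnit_det_massE
  have hMb := hD.isUnit_det_massB
  have hpart := fun k => D.solvesBracket_iff (D.bracket_partHamiltonian hω hMe hMb k)
  refine ⟨D.hamiltonian_eq_sum, D.solvesBracket_iff (D.bracket_hamiltonian hω hMe hMb), hpart,
    fun k z I γ hI hc h0 => ?_, hD.isWeakDiv_flow_iff,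
    fun l z hz => hD.isWeakDiv_iterate_compose l hz,
    fun l => ⟨hD.contDiff_compose l, fun F G hF hG z hz => hD.bracket_compose l hF hG hz⟩,
    hD.exists_isLocalSolution, hD.hasOrder_firstOrderScheme, hD.hasOrder_secondOrderScheme,
    VMPIC.Discretisation.Admissible.secondOrderScheme_symm⟩
  rw [hpart]
  exact hD.eq_flow_iff k z hI hc h0
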